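/- Let $(\Omega,\mathcal F,\mathbb P)$ be a probability space with a measure-preserving (not necessarily invertible or ergodic) transformation $\theta$, and let $X$ be a non-empty compact metrizable space with its Borel $\sigma$-algebra. Let $T=(T_\omega)_{\omega\in\Omega}$ be a continuous random dynamical system over $\theta$: the map $(\omega,x)\mapsto T_\omega x\in X$ is measurable for $\mathcal F\otimes\mathcal B(X)$ and each $T_\omega:X\to X$ is continuous. Put $T_\omega^0=\mathrm{id}$ and $T_\omega^n=T_{\theta^{n-1}\omega}\circ\cdots\circ T_\omega$ for $n\ge 1$. Let $L^1(\Omega,C(X))$ be the set of functions $f:\Omega\times X\to\mathbb R$ that are measurable in $(\omega,x)$, continuous in $x$, and satisfy $\int\sup_{x\in X}|f(\omega,x)|\,d\mathbb P(\omega)<\infty$. For a metric $d$ compatible with the topology of $X$, $n\ge 1$ and $0<\epsilon<1$ put $$d_n^\omega(x,y)=\max_{0\le j\le n-1}d(T_\omega^jx,T_\omega^jy),\qquad S_nf(\omega,x)=\sum_{j=0}^{n-1}f(\theta^j\omega,T_\omega^jx),$$ $$P_n(T,f,d,\omega,\epsilon)=\sup\Big\{\sum_{x\in F}(1/\epsilon)^{S_nf(\omega,x)}:\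 F\subset X,\ d_n^\omega(x,y)>\epsilon\text{ for all distinct }x,y\in F\Big\},$$ $$P(T,f,d,\epsilon)=\limsup_{n\to\infty}\frac1n\int\log P_n(T,f,d,\omega,\epsilon)\,d\mathbb P(\omega),$$ and define the upper and lower metric mean dimension with potential $f$ as $$\mathbb E\overline{\mathrm{mdim}}_M(T,f,d)=\limsup_{\epsilon\to0}\frac{P(T,f,d,\epsilon)}{\log\frac1\epsilon},\qquad \mathbb E\underline{\mathrm{mdim}}_M(T,f,d)=\liminf_{\epsilon\to0}\frac{P(T,f,d,\epsilon)}{\log\frac1\epsilon}$$ (values in $[-\infty,\infty]$). Proposition 2.2. For every $f\in L^1(\Omega,C(X))$ and every metric $d$ compatible with the topology of $X$, the following holds. For all $0<\epsilon<1$ and $n\ge1$, $P_n(T,f,d,\omega,\epsilon)$ is finite for every $\omega$ and measurable in $\omega$, and $\log P_n(T,f,d,\cdot,\epsilon)$ is $\mathbb P$-integrable; moreover $\limsup_{n\to\infty}\frac1n\log P_n(T,f,d,\omega,\epsilon)$ is finite for $\mathbb P$-a.e. $\omega$ and $\mathbb P$-integrable. Furthermore, $$\mathbb E\overline{\mathrm{mdim}}_M(T,f,d)=\limsup_{\epsilon\to0}\frac1{\log\frac1\epsilon}\int\limsup_{n\to\infty}\frac1n\log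 P_n(T,f,d,\omega,\epsilon)\,d\mathbb P(\omega),$$ $$\mathbb E\underline{\mathrm{mdim}}_M(T,f,d)=\liminf_{\epsilon\to0}\frac1{\log\frac1\epsilon}\int\limsup_{n\to\infty}\frac1n\log P_n(T,f,d,\omega,\epsilon)\,d\mathbb P(\omega).$$ -/

import Mathlib

open MeasureTheory Filter Topology

noncomputable section

namespace RandomMdim

variable {Ω X : Type*}

/-- The fibre maps `T_ω : X → X` of a continuous random dynamical system: `(ω, x) ↦ T_ω x` is
measurable for the product `σ`-algebra and every `T_ω` is continuous. The base transformation `θ`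
is a separate datum. -/
structure FibreMaps (Ω X : Type*) [MeasurableSpace Ω] [TopologicalSpace X]
    [MeasurableSpace X] where
  map : Ω → X → X
  measurable_map : Measurable (fun p : Ω × X => map p.1 p.2)
  continuous_map : ∀ ω, Continuous (map ω)

/-- The iterates `T_ω^n = T_{θ^{n-1} ω} ∘ ⋯ ∘ T_{θ ω} ∘ T_ω`, with `T_ω^0 = id`. -/
def FibreMaps.iter [MeasurableSpace Ω] [TopologicalSpace X] [MeasurableSpace X]
    (T : FibreMaps Ω X) (θ : Ω → Ω) : ℕ → Ω → X → X
  | 0, _, x => x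
  | n + 1, ω, x => T.map (θ^[n] ω) (T.iter θ n ω x)

/-- `f` belongs to `L¹(Ω, C(X))`: it is jointly measurable, continuous in `x`, and
`ω ↦ ‖f(ω)‖_∞` is integrable. -/
structure MemL1C [MeasurableSpace Ω] [TopologicalSpace X] [CompactSpace X] [MeasurableSpace X]
    (P : Measure Ω) (f : Ω → C(X, ℝ)) : Prop where
  measurable : Measurable (fun p : Ω × X => f p.1 p.2)
  integrable_norm : Integrable (fun ω => ‖f ω‖) P

section

variable [MeasurableSpace Ω] [TopologicalSpace X] [MeasurableSpace X]

/-- The Bowen metric `d_n^ω(x, y) = max_{0 ≤ j ≤ n - 1} d(T_ω^j x, T_ω^j y)` (for `n ≥ 1`). -/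
def bowenDist (T : FibreMaps Ω X) (θ : Ω → Ω) (d : MetricSpace X) (n : ℕ) (ω : Ω)
    (x y : X) : ℝ :=
  ⨆ j : Fin n, d.dist (T.iter θ j ω x) (T.iter θ j ω y)

/-- `F` is `(ω, n, ε)`-separated. -/
def IsSep (T : FibreMaps Ω X) (θ : Ω → Ω) (d : MetricSpace X) (n : ℕ) (ω : Ω) (ε : ℝ)
    (F : Set X) : Prop :=
  ∀ x ∈ F, ∀ y ∈ F, x ≠ y → ε < bowenDist T θ d n ω x y

/-- `S_n f(ω, x) = ∑_{j < n} f(θ^j ω, T_ω^j x)`. -/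
def fibreSum (T : FibreMaps Ω X) (θ : Ω → Ω) (f : Ω → C(X, ℝ)) (n : ℕ) (ω : Ω) (x : X) : ℝ :=
  ∑ j ∈ Finset.range n, f (θ^[j] ω) (T.iter θ j ω x)

/-- All sums `∑_{x ∈ F} (1/ε)^{S_n f(ω, x)}` over `(ω, n, ε)`-separated sets `F`. (On a compact
space every separated set is finite, so that finite sets `F` are all of them.) -/
def sepSums (T : FibreMaps Ω X) (θ : Ω → Ω) (f : Ω → C(X, ℝ)) (d : MetricSpace X) (n : ℕ)
    (ω : Ω) (ε : ℝ) : Set ℝ :=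
  {s | ∃ F : Finset X, IsSep T θ d n ω ε (F : Set X) ∧
    s = ∑ x ∈ F, (1 / ε) ^ fibreSum T θ f n ω x}

/-- `P_n(T, f, d, ω, ε)`. -/
def sepP (T : FibreMaps Ω X) (θ : Ω → Ω) (f : Ω → C(X, ℝ)) (d : MetricSpace X) (n : ℕ)
    (ω : Ω) (ε : ℝ) : ℝ :=
  sSup (sepSums T θ f d n ω ε)

/-- `P(T, f, d, ε) = limsup_n (1/n) ∫ log P_n(T, f, d, ω, ε) dP(ω)`. -/
def pressure (P : Measure Ω) (T : FibreMaps Ω X) (θ : Ω → Ω) (f : Ω → C(X, ℝ))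
    (d : MetricSpace X) (ε : ℝ) : EReal :=
  limsup (fun n : ℕ =>
    (((1 / (n : ℝ)) * ∫ ω, Real.log (sepP T θ f d n ω ε) ∂P : ℝ) : EReal)) atTop

/-- The upper metric mean dimension with potential `f`. -/
def upperMdim (P : Measure Ω) (T : FibreMaps Ω X) (θ : Ω → Ω) (f : Ω → C(X, ℝ))
    (d : MetricSpace X) : EReal :=
  limsup (fun ε : ℝ => pressure P T θ f d ε / ((Real.log (1 / ε) : ℝ) : EReal)) (𝓝[>] 0)

/-- The lower metric mean dimension with potential `f`. -/
def lowerMdim (P : Measure Ω) (T : FibreMaps Ω X) (θ : Ω → Ω) (f : Ω → C(X, ℝ))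
    (d : MetricSpace X) : EReal :=
  liminf (fun ε : ℝ => pressure P T θ f d ε / ((Real.log (1 / ε) : ℝ) : EReal)) (𝓝[>] 0)

/-- The fibrewise growth rate `limsup_n (1/n) log P_n(T, f, d, ω, ε)`, as an extended real. -/
def fibreGrowth (T : FibreMaps Ω X) (θ : Ω → Ω) (f : Ω → C(X, ℝ)) (d : MetricSpace X)
    (ε : ℝ) (ω : Ω) : EReal :=
  limsup (fun n : ℕ =>
    (((1 / (n : ℝ)) * Real.log (sepP T θ f d n ω ε) : ℝ) : EReal)) atTop

end

end RandomMdim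

end

/-! The fixed-scale quantities P(T, f, d, ε) and ∫ limsup (1/n) log P_n are not shown to be equal;
they are sandwiched with a change of scale whose cost is o(log(1/ε)).

Upper bound for the pressure: |log P_n| is dominated by Birkhoff sums of the integrable function C +
log(1/ε)‖f‖. Their averages converge almost everywhere and have constant mean, so a reverse Fatou
lemma moves the limsup inside the integral (`pressure_le_integral_fibreGrowth`).

Lower bound: separated sums are not submultiplicative in n, but sums over weighted colourings
(`CovBy`) are, and they dominate separated sums at the same scale. A maximal ε-separated set is
ε-spanning, hence gives a colouring at scale 2ε (`covBy_two_mul`). Cutting time into blocks of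
length m and applying Birkhoff's theorem to θ^m bounds the mean growth at scale 2ε by (1/m)∫ log
P_m(ε) + ∫ `scaleExcess`, for every m ≥ 1 (`integral_fibreGrowth_two_mul_le`). No ergodicity is
needed, since the limiting conditional expectation has the same integral.

The excess is log(1/(2ε)) times the 2ε-oscillation of f, plus log 2 · ‖f‖. The mean oscillation
tends to 0 by dominated convergence, so after division by log(1/(2ε)) the excess vanishes and
log(1/ε)/log(1/(2ε)) tends to 1. -/

noncomputable section

namespace RandomMdim

universe u

/-! ### Maximal ergodic inequality and Birkhoff's pointwise theorem -/

section Birkhoff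

variable {α : Type*}

/-- The running maximum `max_{0 ≤ k ≤ n} ∑_{j < k} f(θ^j x)` of the Birkhoff sums of `f`. -/
def maxBirkhoffSum (θ : α → α) (f : α → ℝ) : ℕ → α → ℝ
  | 0, _ => 0
  | n + 1, x => max 0 (f x + maxBirkhoffSum θ f n (θ x))

variable {θ : α → α} {f : α → ℝ}

lemma maxBirkhoffSum_nonneg (n : ℕ) (x : α) : 0 ≤ maxBirkhoffSum θ f n x := by
  cases n with
  | zero => exact le_rfl
  | succ n => exact le_max_left _ _

lemma maxBirkhoffSum_le_succ (n : ℕ) (x : α) :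
    maxBirkhoffSum θ f n x ≤ maxBirkhoffSum θ f (n + 1) x := by
  induction n generalizing x with
  | zero => exact le_max_left _ _
  | succ n ih => exact max_le_max le_rfl (add_le_add le_rfl (ih (θ x)))

lemma maxBirkhoffSum_mono (x : α) : Monotone fun n => maxBirkhoffSum θ f n x :=
  monotone_nat_of_le_succ fun n => maxBirkhoffSum_le_succ n x

lemma birkhoffSum_le_maxBirkhoffSum (n : ℕ) (x : α) :
    birkhoffSum θ f n x ≤ maxBirkhoffSum θ f n x := by
  induction n generalizing x with
  | zero => simp [maxBirkhoffSum]
  | succ n ih =>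
    rw [birkhoffSum_succ']
    exact le_max_of_le_right (add_le_add le_rfl (ih (θ x)))

lemma exists_maxBirkhoffSum_eq (n : ℕ) (x : α) :
    ∃ k, maxBirkhoffSum θ f n x = birkhoffSum θ f k x := by
  induction n generalizing x with
  | zero => exact ⟨0, by simp [maxBirkhoffSum]⟩
  | succ n ih =>
    obtain ⟨k, hk⟩ := ih (θ x)
    rcases max_choice 0 (f x + maxBirkhoffSum θ f n (θ x)) with h | h
    · exact ⟨0, by simp [maxBirkhoffSum, h]⟩
    · exact ⟨k + 1, by rw [maxBirkhoffSum, h, birkhoffSum_succ', hk]⟩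

variable [MeasurableSpace α] {μ : Measure α}

lemma measurable_maxBirkhoffSum (hθ : Measurable θ) (hf : Measurable f) (n : ℕ) :
    Measurable (maxBirkhoffSum θ f n) := by
  induction n with
  | zero => exact measurable_const
  | succ n ih => exact measurable_const.max (hf.add (ih.comp hθ))

lemma integrable_maxBirkhoffSum (hθ : MeasurePreserving θ μ μ) (hf : Integrable f μ) (n : ℕ) :
    Integrable (maxBirkhoffSum θ f n) μ := by
  induction n with
  | zero => exact integrable_zero _ _ _
  | succ n ih =>
    exact (integrable_zero _ _ _).sup (hf.add (hθ.integrable_comp_of_integrable ih))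

/-- The maximal ergodic inequality, for finitely many Birkhoff sums. -/
lemma setIntegral_maxBirkhoffSum_pos_nonneg (hθ : MeasurePreserving θ μ μ) (hfm : Measurable f)
    (hf : Integrable f μ) (n : ℕ) :
    0 ≤ ∫ x in {x | 0 < maxBirkhoffSum θ f n x}, f x ∂μ := by
  set M := maxBirkhoffSum θ f n
  have hMm : Measurable M := measurable_maxBirkhoffSum hθ.measurable hfm n
  have hM : Integrable M μ := integrable_maxBirkhoffSum hθ hf n
  have hMθ : Integrable (fun x => M (θ x)) μ := hθ.integrable_comp_of_integrable hM
  set A := {x | 0 < M x}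
  have hA : MeasurableSet A := measurableSet_lt measurable_const hMm
  have h1 : ∫ x in A, M x ∂μ = ∫ x, M x ∂μ := by
    refine setIntegral_eq_integral_of_forall_compl_eq_zero fun x hx => ?_
    exact le_antisymm (not_lt.1 hx) (maxBirkhoffSum_nonneg n x)
  have h2 : ∫ x in A, M (θ x) ∂μ ≤ ∫ x, M (θ x) ∂μ :=
    setIntegral_le_integral hMθ (Eventually.of_forall fun x => maxBirkhoffSum_nonneg n (θ x))
  have h3 : ∫ x, M (θ x) ∂μ = ∫ x, M x ∂μ := by
    rw [← integral_map (f := M) hθ.measurable.aemeasurable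
      (by rw [hθ.map_eq]; exact hM.aestronglyMeasurable), hθ.map_eq]
  -- Where the maximum is positive it is attained by a nonempty sum, so M x ≤ f x + M (θ x). By
  -- invariance of μ, M and M ∘ θ have equal integrals, and restricting to A loses nothing for M.
  have h4 : ∫ x in A, (M x - M (θ x)) ∂μ ≤ ∫ x in A, f x ∂μ := by
    refine setIntegral_mono_on (hM.sub hMθ).integrableOn hf.integrableOn hA fun x hx => ?_
    have hx' : 0 < M x := hx
    have : M x ≤ f x + M (θ x) := by
      cases n with
      | zero => exact absurd hx' (lt_irrefl _)
      | succ n =>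
        have hle := maxBirkhoffSum_le_succ (θ := θ) (f := f) n (θ x)
        change 0 < max 0 (f x + maxBirkhoffSum θ f n (θ x)) at hx'
        change max 0 (f x + maxBirkhoffSum θ f n (θ x)) ≤ f x + maxBirkhoffSum θ f (n + 1) (θ x)
        rcases lt_max_iff.1 hx' with h | h
        · exact absurd h (lt_irrefl _)
        · rw [max_eq_right h.le]; linarith
    linarith
  rw [integral_sub hM.integrableOn hMθ.integrableOn] at h4
  linarith

/-- The maximal ergodic inequality, over an invariant set on which some Birkhoff sum is positive. -/
lemma setIntegral_nonneg_of_exists_birkhoffSum_pos (hθ : MeasurePreserving θ μ μ)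
    (hfm : Measurable f) (hf : Integrable f μ) {E : Set α} (hE : MeasurableSet E)
    (hEθ : θ ⁻¹' E = E) (hpos : ∀ x ∈ E, ∃ n, 0 < birkhoffSum θ f n x) :
    0 ≤ ∫ x in E, f x ∂μ := by
  -- Truncation to the invariant set E keeps the sums on E and kills them off E, so the sets where
  -- the running maximum is positive increase exactly to E.
  set g := E.indicator f
  have hmem : ∀ x, θ x ∈ E ↔ x ∈ E := fun x => by
    rw [← Set.mem_preimage, hEθ]
  have hmem' : ∀ (k : ℕ) x, θ^[k] x ∈ E ↔ x ∈ E := by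
    intro k
    induction k with
    | zero => simp
    | succ k ih => intro x; rw [Function.iterate_succ_apply, ih, hmem]
  have hgE : ∀ n, ∀ x ∈ E, birkhoffSum θ g n x = birkhoffSum θ f n x := fun n x hx =>
    Finset.sum_congr rfl fun k _ => Set.indicator_of_mem ((hmem' k x).2 hx) f
  have hgE' : ∀ n, ∀ x ∉ E, birkhoffSum θ g n x = 0 := fun n x hx =>
    Finset.sum_eq_zero fun k _ => Set.indicator_of_notMem (fun h => hx ((hmem' k x).1 h)) f
  have hgm : Measurable g := hfm.indicator hE
  have hg : Integrable g μ := hf.indicator hE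
  have hU : ⋃ n, {x | 0 < maxBirkhoffSum θ g n x} = E := by
    ext x
    simp only [Set.mem_iUnion, Set.mem_ofPred_eq]
    constructor
    · rintro ⟨n, hn⟩
      by_contra hx
      obtain ⟨k, hk⟩ := exists_maxBirkhoffSum_eq (θ := θ) (f := g) n x
      rw [hk, hgE' k x hx] at hn
      exact lt_irrefl _ hn
    · intro hx
      obtain ⟨n, hn⟩ := hpos x hx
      rw [← hgE n x hx] at hn
      exact ⟨n, hn.trans_le (birkhoffSum_le_maxBirkhoffSum n x)⟩
  have hlim := tendsto_setIntegral_of_monotone (μ := μ) (f := g)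
    (s := fun n => {x | 0 < maxBirkhoffSum θ g n x})
    (fun n => measurableSet_lt measurable_const (measurable_maxBirkhoffSum hθ.measurable hgm n))
    (fun m n hmn x hx => lt_of_lt_of_le hx (maxBirkhoffSum_mono x hmn)) hg.integrableOn
  rw [hU] at hlim
  have h0 : 0 ≤ ∫ x in E, g x ∂μ :=
    ge_of_tendsto' hlim fun n => setIntegral_maxBirkhoffSum_pos_nonneg hθ hgm hg n
  rwa [setIntegral_congr_fun hE (fun x hx => Set.indicator_of_mem hx f)] at h0

lemma integrable_birkhoffSum (hθ : MeasurePreserving θ μ μ) (hf : Integrable f μ) (n : ℕ) :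
    Integrable (birkhoffSum θ f n) μ :=
  integrable_finsetSum _ fun k _ => (hθ.iterate k).integrable_comp_of_integrable hf

lemma integral_birkhoffSum (hθ : MeasurePreserving θ μ μ) (hf : Integrable f μ) (n : ℕ) :
    ∫ x, birkhoffSum θ f n x ∂μ = n * ∫ x, f x ∂μ := by
  have h : ∀ k : ℕ, ∫ x, f (θ^[k] x) ∂μ = ∫ x, f x ∂μ := fun k => by
    have hk := hθ.iterate k
    rw [← integral_map (f := f) hk.measurable.aemeasurable
      (by rw [hk.map_eq]; exact hf.aestronglyMeasurable), hk.map_eq]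
  have h' : ∀ k : ℕ, Integrable (fun x => f (θ^[k] x)) μ := fun k =>
    (hθ.iterate k).integrable_comp_of_integrable hf
  simp only [birkhoffSum]
  rw [integral_finsetSum _ fun k _ => h' k]
  simp [h]

variable [IsFiniteMeasure μ]

/-- If `f` has integral at most `-ε μ(E)` over all invariant sets `E`, its Birkhoff sums are
almost everywhere bounded above. -/
lemma ae_bddAbove_birkhoffSum (hθ : MeasurePreserving θ μ μ) (hfm : Measurable f)
    (hf : Integrable f μ) {ε : ℝ} (hε : 0 < ε)
    (hint : ∀ E, MeasurableSet[MeasurableSpace.invariants θ] E →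
      ∫ x in E, f x ∂μ ≤ -ε * μ.real E) :
    ∀ᵐ x ∂μ, ∃ K : ℕ, ∀ n, birkhoffSum θ f n x ≤ K := by
  set E : Set α := {x | ∀ K : ℕ, ∃ n, (K : ℝ) < birkhoffSum θ f n x} with hEdef
  have hEm : MeasurableSet E := by
    have : E = ⋂ K : ℕ, ⋃ n, {x | (K : ℝ) < birkhoffSum θ f n x} := by
      ext x; simp [hEdef]
    rw [this]
    refine MeasurableSet.iInter fun K => MeasurableSet.iUnion fun n =>
      measurableSet_lt measurable_const ?_
    exact Finset.measurable_sum _ fun k _ => hfm.comp (hθ.measurable.iterate k)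
  -- Passing from x to θ x shifts the sums by the fixed amount f x, which does not affect
  -- unboundedness.
  have hEθ : θ ⁻¹' E = E := by
    ext x
    simp only [Set.mem_preimage, hEdef, Set.mem_ofPred_eq]
    constructor
    · intro h K
      obtain ⟨L, hL⟩ := exists_nat_ge ((K : ℝ) - f x)
      obtain ⟨n, hn⟩ := h L
      exact ⟨n + 1, by rw [birkhoffSum_succ']; linarith⟩
    · intro h K
      obtain ⟨L, hL⟩ := exists_nat_ge ((K : ℝ) + f x)
      obtain ⟨n, hn⟩ := h L
      cases n with
      | zero => exact absurd hn (by simp)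
      | succ n => exact ⟨n, by rw [birkhoffSum_succ'] at hn; linarith⟩
  have h1 := setIntegral_nonneg_of_exists_birkhoffSum_pos hθ hfm hf hEm hEθ
    (fun x hx => by simpa using hx 0)
  have h2 := hint E (MeasurableSpace.measurableSet_invariants.2 ⟨hEm, hEθ⟩)
  have h3 : μ.real E = 0 := by
    have := measureReal_nonneg (μ := μ) (s := E)
    nlinarith
  have h4 : μ E = 0 := (measureReal_eq_zero_iff).1 h3
  filter_upwards [measure_eq_zero_iff_ae_notMem.1 h4] with x hx
  simpa [hEdef] using hx

/-- The function f - (φ + ε), with φ the conditional expectation, has integral exactly -ε μ(E) over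
each invariant E, so its sums are bounded by some K. One ε comes from this shift, the other from K /
n < ε. -/
lemma ae_eventually_birkhoffSum_le (hθ : MeasurePreserving θ μ μ) (hfm : Measurable f)
    (hf : Integrable f μ) {ε : ℝ} (hε : 0 < ε) :
    ∀ᵐ x ∂μ, ∀ᶠ n : ℕ in atTop,
      birkhoffSum θ f n x / n ≤ (μ[f | MeasurableSpace.invariants θ]) x + 2 * ε := by
  have hI := MeasurableSpace.invariants_le θ
  set φ : α → ℝ := μ[f | MeasurableSpace.invariants θ]
  have hφI : StronglyMeasurable[MeasurableSpace.invariants θ] φ := stronglyMeasurable_condExp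
  have hφm : Measurable φ := (hφI.mono hI).measurable
  have hφθ : φ ∘ θ = φ := MeasurableSpace.comp_eq_of_measurable_invariants hφI.measurable
  have hφ : Integrable φ μ := integrable_condExp
  have hφε' : Integrable (fun x => φ x + ε) μ := hφ.add (integrable_const ε)
  have hφε : (fun x => φ x + ε) ∘ θ = fun x => φ x + ε := by
    ext x; exact congrArg (· + ε) (congrFun hφθ x)
  have key := ae_bddAbove_birkhoffSum (f := fun x => f x - (φ x + ε)) hθ
    (hfm.sub (hφm.add_const ε)) (hf.sub hφε') hε (fun E hE => by
      rw [integral_sub hf.integrableOn hφε'.integrableOn,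
        integral_add hφ.integrableOn (integrable_const ε).integrableOn,
        setIntegral_condExp hI hf hE, setIntegral_const, smul_eq_mul]
      linarith [mul_comm ε (μ.real E)])
  filter_upwards [key] with x ⟨K, hK⟩
  have hlim : Tendsto (fun n : ℕ => (K : ℝ) / n) atTop (𝓝 0) :=
    tendsto_const_div_atTop_nhds_zero_nat _
  filter_upwards [hlim.eventually (gt_mem_nhds hε), eventually_gt_atTop 0] with n hn hn0
  have hn0' : (0 : ℝ) < n := Nat.cast_pos.2 hn0
  have h := hK n
  have hsub : birkhoffSum θ (fun x => f x - (φ x + ε)) n x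
      = birkhoffSum θ f n x - n * (φ x + ε) := by
    have := birkhoffSum_sub θ f (fun x => φ x + ε) n x
    rw [birkhoffSum_of_comp_eq hφε] at this
    simpa [Pi.sub_def, mul_add] using this
  rw [hsub] at h
  rw [div_lt_iff₀ hn0'] at hn
  rw [div_le_iff₀ hn0']
  nlinarith

/-- The one-sided bound for f and for -f gives both inequalities; errors 1/(k+1) keep the
exceptional set a countable union of null sets. -/
lemma ae_tendsto_birkhoffSum_div_of_measurable (hθ : MeasurePreserving θ μ μ)
    (hfm : Measurable f) (hf : Integrable f μ) :
    ∀ᵐ x ∂μ, Tendsto (fun n : ℕ => birkhoffSum θ f n x / n) atTop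
      (𝓝 ((μ[f | MeasurableSpace.invariants θ]) x)) := by
  have h1 : ∀ᵐ x ∂μ, ∀ k : ℕ, ∀ᶠ n : ℕ in atTop, birkhoffSum θ f n x / n ≤
      (μ[f | MeasurableSpace.invariants θ]) x + 2 * (1 / ((k : ℝ) + 1)) :=
    ae_all_iff.2 fun k => ae_eventually_birkhoffSum_le hθ hfm hf Nat.one_div_pos_of_nat
  have h2 : ∀ᵐ x ∂μ, ∀ k : ℕ, ∀ᶠ n : ℕ in atTop, birkhoffSum θ (-f) n x / n ≤
      (μ[-f | MeasurableSpace.invariants θ]) x + 2 * (1 / ((k : ℝ) + 1)) :=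
    ae_all_iff.2 fun k => ae_eventually_birkhoffSum_le hθ hfm.neg hf.neg Nat.one_div_pos_of_nat
  filter_upwards [h1, h2, condExp_neg f (MeasurableSpace.invariants θ)] with x hx1 hx2 hx3
  rw [Metric.tendsto_nhds]
  intro δ hδ
  obtain ⟨k, hk⟩ := exists_nat_one_div_lt (half_pos hδ)
  filter_upwards [hx1 k, hx2 k] with n h1 h2
  have hneg : birkhoffSum θ (-f) n x = - birkhoffSum θ f n x := birkhoffSum_neg θ f n x
  rw [hx3, hneg, neg_div, Pi.neg_apply] at h2
  rw [Real.dist_eq, abs_lt]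
  constructor <;> linarith

/-- **Birkhoff's pointwise ergodic theorem** for a transformation preserving a finite measure. -/
theorem ae_tendsto_birkhoffSum_div (hθ : MeasurePreserving θ μ μ) (hf : Integrable f μ) :
    ∀ᵐ x ∂μ, Tendsto (fun n : ℕ => birkhoffSum θ f n x / n) atTop
      (𝓝 ((μ[f | MeasurableSpace.invariants θ]) x)) := by
  have hae := hf.aestronglyMeasurable.ae_eq_mk
  set g := hf.aestronglyMeasurable.mk f
  have hgm : Measurable g := hf.aestronglyMeasurable.stronglyMeasurable_mk.measurable
  have hsum : ∀ᵐ x ∂μ, ∀ k : ℕ, f (θ^[k] x) = g (θ^[k] x) :=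
    ae_all_iff.2 fun k => (hθ.iterate k).quasiMeasurePreserving.ae hae
  filter_upwards [ae_tendsto_birkhoffSum_div_of_measurable hθ hgm (hf.congr hae), hsum,
    condExp_congr_ae (m := MeasurableSpace.invariants θ) hae] with x hx hs hc
  rw [hc]
  refine hx.congr fun n => ?_
  simp only [birkhoffSum, hs]

end Birkhoff

/-! ### Reverse Fatou lemma and limits under a change of scale -/

section Limits

/-- A reverse Fatou lemma: the functions `a n` lie below functions `L n` that converge almost
everywhere and in mean. -/
theorem eventually_integral_lt_of_dominated {Ω : Type*} [MeasurableSpace Ω] {μ : Measure Ω}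
    {a L : ℕ → Ω → ℝ} {L' G : Ω → ℝ} (ha : ∀ n, Integrable (a n) μ)
    (hL : ∀ n, Integrable (L n) μ) (haL : ∀ n ω, a n ω ≤ L n ω)
    (hLlim : ∀ᵐ ω ∂μ, Tendsto (fun n => L n ω) atTop (𝓝 (L' ω))) (hL' : Integrable L' μ)
    (hLint : Tendsto (fun n => ∫ ω, L n ω ∂μ) atTop (𝓝 (∫ ω, L' ω ∂μ)))
    (hG : Integrable G μ) (hGa : ∀ᵐ ω ∂μ, ∀ δ > 0, ∀ᶠ n in atTop, a n ω < G ω + δ)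
    {δ : ℝ} (hδ : 0 < δ) :
    ∀ᶠ n in atTop, ∫ ω, a n ω ∂μ < ∫ ω, G ω ∂μ + δ := by
  -- Fatou's lemma for the nonnegative functions L n - a n.
  have hfatou : ENNReal.ofReal (∫ ω, L' ω ∂μ - ∫ ω, G ω ∂μ) ≤
      liminf (fun n => ENNReal.ofReal (∫ ω, L n ω ∂μ - ∫ ω, a n ω ∂μ)) atTop := by
    calc ENNReal.ofReal (∫ ω, L' ω ∂μ - ∫ ω, G ω ∂μ)
        = ENNReal.ofReal (∫ ω, (L' ω - G ω) ∂μ) := by rw [integral_sub hL' hG]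
      _ ≤ ∫⁻ ω, ENNReal.ofReal (L' ω - G ω) ∂μ := by
          have hint : Integrable (fun ω => L' ω - G ω) μ := hL'.sub hG
          rw [integral_eq_lintegral_pos_part_sub_lintegral_neg_part hint]
          refine ENNReal.ofReal_le_of_le_toReal ?_
          exact sub_le_self _ ENNReal.toReal_nonneg
      _ ≤ ∫⁻ ω, liminf (fun n => ENNReal.ofReal (L n ω - a n ω)) atTop ∂μ := by
          refine lintegral_mono_ae ?_
          filter_upwards [hLlim, hGa] with ω h1 h2
          have hcont : Tendsto (fun δ : ℝ => ENNReal.ofReal (L' ω - G ω - 2 * δ)) (𝓝[>] 0)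
              (𝓝 (ENNReal.ofReal (L' ω - G ω))) := by
            have : Continuous fun δ : ℝ => ENNReal.ofReal (L' ω - G ω - 2 * δ) :=
              ENNReal.continuous_ofReal.comp (by fun_prop)
            have h := this.tendsto 0
            simp only [mul_zero, sub_zero] at h
            exact h.mono_left nhdsWithin_le_nhds
          refine le_of_tendsto hcont ?_
          filter_upwards [self_mem_nhdsWithin] with δ hδ
          have hδ' : (0 : ℝ) < δ := hδ
          refine le_liminf_of_le (by isBoundedDefault) ?_
          filter_upwards [h2 δ hδ', h1.eventually (lt_mem_nhds (sub_lt_self _ hδ'))] with n h3 h4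
          exact ENNReal.ofReal_le_ofReal (by linarith)
      _ ≤ liminf (fun n => ∫⁻ ω, ENNReal.ofReal (L n ω - a n ω) ∂μ) atTop :=
          lintegral_liminf_le' fun n =>
            ((hL n).sub (ha n)).aestronglyMeasurable.aemeasurable.ennreal_ofReal
      _ = liminf (fun n => ENNReal.ofReal (∫ ω, L n ω ∂μ - ∫ ω, a n ω ∂μ)) atTop := by
          congr 1
          ext n
          rw [← integral_sub (hL n) (ha n)]
          exact (ofReal_integral_eq_lintegral_ofReal ((hL n).sub (ha n))
            (Eventually.of_forall fun ω => sub_nonneg.2 (haL n ω))).symm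
  by_contra hcon
  have hfreq : ∃ᶠ n in atTop, ∫ ω, L n ω ∂μ - ∫ ω, a n ω ∂μ ≤
      ∫ ω, L' ω ∂μ - ∫ ω, G ω ∂μ - δ / 2 := by
    refine ((not_eventually.1 hcon).and_eventually
      (hLint.eventually (gt_mem_nhds (lt_add_of_pos_right _ (half_pos hδ))))).mono ?_
    rintro n ⟨h1, h2⟩
    linarith [not_lt.1 h1]
  -- A single such n shows that ∫ L' - ∫ G ≥ δ / 2 > 0; without positivity `ENNReal.ofReal` could
  -- lose the strict inequality.
  obtain ⟨n, hn⟩ := hfreq.exists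
  have hmono : ∫ ω, a n ω ∂μ ≤ ∫ ω, L n ω ∂μ := integral_mono (ha n) (hL n) (haL n)
  have hle := hfatou.trans (liminf_le_of_frequently_le'
    (hfreq.mono fun n hn => ENNReal.ofReal_le_ofReal hn))
  refine absurd hle (not_le.2 ((ENNReal.ofReal_lt_ofReal_iff ?_).2 ?_)) <;> linarith

lemma map_two_mul_nhdsGT_zero : map (fun ε : ℝ => 2 * ε) (𝓝[>] 0) = 𝓝[>] 0 := by
  have key : ∀ c : ℝ, 0 < c → Tendsto (fun ε : ℝ => c * ε) (𝓝[>] 0) (𝓝[>] 0) := fun c hc => by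
    refine tendsto_nhdsWithin_iff.2 ⟨?_, ?_⟩
    · have h : Tendsto (fun ε : ℝ => c * ε) (𝓝 0) (𝓝 (c * 0)) :=
        (continuous_const_mul c).tendsto 0
      rw [mul_zero] at h
      exact h.mono_left nhdsWithin_le_nhds
    · filter_upwards [self_mem_nhdsWithin] with ε hε
      exact mul_pos hc hε
  refine le_antisymm (key 2 two_pos) ?_
  have h := map_mono (m := fun ε : ℝ => 2 * ε) (key (1 / 2) (by norm_num))
  rw [map_map] at h
  convert h using 1
  rw [show ((fun ε : ℝ => 2 * ε) ∘ fun ε => 1 / 2 * ε) = id by ext ε; simp, map_id]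

variable {g s c e : ℝ → ℝ}

/-- The limit at 0 does not see the factor 2. Testing against real z above the limsup of g covers
infinite values, where c ε * g ε could not be passed to the limit directly. -/
theorem limsup_le_limsup_of_two_mul_le (hc : Tendsto c (𝓝[>] 0) (𝓝 1))
    (he : Tendsto e (𝓝[>] 0) (𝓝 0)) (h : ∀ᶠ ε in 𝓝[>] 0, s (2 * ε) ≤ c ε * g ε + e ε) :
    limsup (fun ε => (s ε : EReal)) (𝓝[>] 0) ≤ limsup (fun ε => (g ε : EReal)) (𝓝[>] 0) := by
  refine EReal.le_of_forall_lt_iff_le.1 fun z hz => ?_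
  have hlim : Tendsto (fun ε => ((c ε * z + e ε : ℝ) : EReal)) (𝓝[>] 0) (𝓝 (z : EReal)) := by
    refine (continuous_coe_real_ereal.tendsto z).comp ?_
    simpa using (hc.mul_const z).add he
  have hs : limsup (fun ε => (s ε : EReal)) (𝓝[>] 0) =
      limsup (fun ε => (s (2 * ε) : EReal)) (𝓝[>] 0) := by
    conv_lhs => rw [← map_two_mul_nhdsGT_zero]
    rfl
  rw [hs, ← hlim.limsup_eq]
  refine limsup_le_limsup ?_
  filter_upwards [h, eventually_lt_of_limsup_lt hz, hc.eventually (lt_mem_nhds one_pos)]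
    with ε h1 h2 h3
  have h2' : g ε < z := EReal.coe_lt_coe_iff.1 h2
  exact EReal.coe_le_coe_iff.2 (h1.trans (by nlinarith))

theorem liminf_le_liminf_of_two_mul_le (hc : Tendsto c (𝓝[>] 0) (𝓝 1))
    (he : Tendsto e (𝓝[>] 0) (𝓝 0)) (h : ∀ᶠ ε in 𝓝[>] 0, s (2 * ε) ≤ c ε * g ε + e ε) :
    liminf (fun ε => (s ε : EReal)) (𝓝[>] 0) ≤ liminf (fun ε => (g ε : EReal)) (𝓝[>] 0) := by
  refine EReal.le_of_forall_lt_iff_le.1 fun z hz => ?_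
  -- The bound g ε < z holds only frequently; a second level z' > z absorbs c and e eventually.
  refine EReal.le_of_forall_lt_iff_le.1 fun z' hz' => ?_
  have hlim : Tendsto (fun ε => c ε * z + e ε) (𝓝[>] 0) (𝓝 z) := by
    simpa using (hc.mul_const z).add he
  have hs : liminf (fun ε => (s ε : EReal)) (𝓝[>] 0) =
      liminf (fun ε => (s (2 * ε) : EReal)) (𝓝[>] 0) := by
    conv_lhs => rw [← map_two_mul_nhdsGT_zero]
    rfl
  rw [hs]
  refine liminf_le_of_frequently_le' ?_
  refine ((frequently_lt_of_liminf_lt (by isBoundedDefault) hz).and_eventually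
    (h.and ((hc.eventually (lt_mem_nhds one_pos)).and
      (hlim.eventually (gt_mem_nhds (EReal.coe_lt_coe_iff.1 hz')))))).mono ?_
  rintro ε ⟨h1, h2, h3, h4⟩
  have h1' : g ε < z := EReal.coe_lt_coe_iff.1 h1
  exact EReal.coe_le_coe_iff.2 (h2.trans (by nlinarith))

end Limits

/-! ### Weighted colourings and separated sums -/

section Colouring

variable {Ω : Type*} {X : Type u} [MeasurableSpace Ω] [d : MetricSpace X] [MeasurableSpace X]
  {T : FibreMaps Ω X} {θ : Ω → Ω} {f : Ω → C(X, ℝ)}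

lemma iter_add (n m : ℕ) (ω : Ω) (x : X) :
    T.iter θ (n + m) ω x = T.iter θ m (θ^[n] ω) (T.iter θ n ω x) := by
  induction m with
  | zero => rfl
  | succ m ih =>
    rw [← add_assoc]
    change T.map (θ^[n + m] ω) (T.iter θ (n + m) ω x) =
      T.map (θ^[m] (θ^[n] ω)) (T.iter θ m (θ^[n] ω) (T.iter θ n ω x))
    rw [ih, ← Function.iterate_add_apply, add_comm m n]

lemma continuous_iter (n : ℕ) (ω : Ω) : Continuous (T.iter θ n ω) := by
  induction n with
  | zero => exact continuous_id
  | succ n ih => exact (T.continuous_map _).comp ih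

lemma bowenDist_le_iff {n : ℕ} {ω : Ω} {x y : X} {ε : ℝ} (hε : 0 ≤ ε) :
    bowenDist T θ d n ω x y ≤ ε ↔ ∀ j < n, dist (T.iter θ j ω x) (T.iter θ j ω y) ≤ ε := by
  constructor
  · intro h j hj
    exact (le_ciSup (f := fun j : Fin n => dist (T.iter θ j ω x) (T.iter θ j ω y))
      (Set.finite_range _).bddAbove ⟨j, hj⟩).trans h
  · intro h
    exact Real.iSup_le (fun j => h j j.2) hε

lemma continuous_bowenDist (n : ℕ) (ω : Ω) :
    Continuous fun p : X × X => bowenDist T θ d n ω p.1 p.2 := by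
  have h : ∀ j : Fin n, Continuous fun p : X × X =>
      dist (T.iter θ j ω p.1) (T.iter θ j ω p.2) := fun j =>
    ((continuous_iter _ ω).comp continuous_fst).dist ((continuous_iter _ ω).comp continuous_snd)
  rcases isEmpty_or_nonempty (Fin n) with hn | hn
  · simp only [bowenDist, Real.iSup_of_isEmpty]
    exact continuous_const
  · have : (fun p : X × X => bowenDist T θ d n ω p.1 p.2) =
        fun p => Finset.univ.sup' Finset.univ_nonempty
          (fun j : Fin n => dist (T.iter θ j ω p.1) (T.iter θ j ω p.2)) := by
      ext p
      rw [Finset.sup'_univ_eq_ciSup]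
      rfl
    rw [this]
    exact Continuous.finset_sup'_apply _ fun j _ => h j

lemma bowenDist_self (n : ℕ) (ω : Ω) (x : X) : bowenDist T θ d n ω x x = 0 := by
  simp [bowenDist]

lemma fibreSum_add (n m : ℕ) (ω : Ω) (x : X) :
    fibreSum T θ f (n + m) ω x =
      fibreSum T θ f n ω x + fibreSum T θ f m (θ^[n] ω) (T.iter θ n ω x) := by
  simp only [fibreSum, Finset.sum_range_add, iter_add]
  simp only [← Function.iterate_add_apply, add_comm]

lemma continuous_fibreSum (n : ℕ) (ω : Ω) : Continuous (fibreSum T θ f n ω) :=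
  continuous_finsetSum _ fun j _ => (f _).continuous.comp (continuous_iter j ω)

/-- `X` can be coloured with finitely many weighted colours, of total weight at most `s`, such that
points of one colour are `ε`-close for the Bowen metric and `b ^ S_n f` is at most the weight. -/
def CovBy (T : FibreMaps Ω X) (θ : Ω → Ω) (f : Ω → C(X, ℝ)) (n : ℕ) (ω : Ω) (ε b s : ℝ) : Prop :=
  ∃ (ι : Type u) (_ : Fintype ι) (c : X → ι) (w : ι → ℝ), (∀ i, 0 ≤ w i) ∧
    (∀ x y, c x = c y → bowenDist T θ d n ω x y ≤ ε) ∧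
    (∀ x, b ^ fibreSum T θ f n ω x ≤ w (c x)) ∧ ∑ i, w i ≤ s

variable {n m : ℕ} {ω : Ω} {ε b s t : ℝ}

lemma CovBy.mono (h : CovBy T θ f n ω ε b s) (hst : s ≤ t) : CovBy T θ f n ω ε b t := by
  obtain ⟨ι, hι, c, w, h1, h2, h3, h4⟩ := h
  exact ⟨ι, hι, c, w, h1, h2, h3, h4.trans hst⟩

lemma CovBy.nonneg (h : CovBy T θ f n ω ε b s) : 0 ≤ s := by
  obtain ⟨ι, hι, c, w, h1, h2, h3, h4⟩ := h
  exact (Finset.sum_nonneg fun i _ => h1 i).trans h4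

lemma covBy_zero (hε : 0 ≤ ε) : CovBy T θ f 0 ω ε b 1 := by
  refine ⟨PUnit, inferInstance, fun _ => PUnit.unit, fun _ => 1, fun _ => zero_le_one, ?_, ?_, ?_⟩
  · intro x y _
    exact (bowenDist_le_iff hε).2 fun j hj => absurd hj (Nat.not_lt_zero j)
  · simp [fibreSum]
  · simp

/-- Colour x by the pair formed by its own colour and the colour of T_ω^n x; weights multiply
because S_n f is a cocycle. The scale ε is not degraded. -/
lemma CovBy.mul (hε : 0 ≤ ε) (hb : 0 < b) (h : CovBy T θ f n ω ε b s)
    (h' : CovBy T θ f m (θ^[n] ω) ε b t) : CovBy T θ f (n + m) ω ε b (s * t) := by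
  have ht := h'.nonneg
  obtain ⟨ι, _, c, w, h1, h2, h3, h4⟩ := h
  obtain ⟨κ, _, c', w', h1', h2', h3', h4'⟩ := h'
  refine ⟨ι × κ, inferInstance, fun x => (c x, c' (T.iter θ n ω x)), fun i => w i.1 * w' i.2,
    fun i => mul_nonneg (h1 _) (h1' _), ?_, ?_, ?_⟩
  · intro x y hxy
    obtain ⟨hc, hc'⟩ := Prod.mk.injEq _ _ _ _ ▸ hxy
    rw [bowenDist_le_iff hε]
    intro j hj
    rcases lt_or_ge j n with hjn | hjn
    · exact (bowenDist_le_iff hε).1 (h2 x y hc) j hjn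
    · obtain ⟨k, rfl⟩ := Nat.exists_eq_add_of_le hjn
      rw [iter_add, iter_add]
      exact (bowenDist_le_iff hε).1 (h2' _ _ hc') k (by omega)
  · intro x
    rw [fibreSum_add, Real.rpow_add hb]
    exact mul_le_mul (h3 x) (h3' _) (Real.rpow_nonneg hb.le _) (h1 _)
  · rw [Fintype.sum_prod_type]
    simp only [← Finset.mul_sum]
    rw [← Finset.sum_mul]
    exact mul_le_mul h4 h4' (Finset.sum_nonneg fun i _ => h1' i)
      ((Finset.sum_nonneg fun i _ => h1 i).trans h4)

/-- Concatenation of `q` blocks of length `m`. -/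
lemma CovBy.blocks (hε : 0 ≤ ε) (hb : 0 < b) {H : Ω → ℝ}
    (h : ∀ ω, CovBy T θ f m ω ε b (Real.exp (H ω))) (q : ℕ) (ω : Ω) :
    CovBy T θ f (m * q) ω ε b (Real.exp (birkhoffSum θ^[m] H q ω)) := by
  induction q with
  | zero => simpa using covBy_zero hε
  | succ q ih =>
    rw [birkhoffSum_succ, Real.exp_add, Nat.mul_succ, ← Function.iterate_mul]
    exact ih.mul hε hb (h _)

/-- Concatenation of blocks of length `m` and of blocks of length `1` for the remainder. -/
lemma CovBy.blocks_add (hε : 0 ≤ ε) (hb : 0 < b) {H K : Ω → ℝ}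
    (hH : ∀ ω, CovBy T θ f m ω ε b (Real.exp (H ω)))
    (hK : ∀ ω, CovBy T θ f 1 ω ε b (Real.exp (K ω))) (hK0 : ∀ ω, 0 ≤ K ω) (hm : 0 < m) (n : ℕ)
    (ω : Ω) :
    CovBy T θ f n ω ε b (Real.exp (birkhoffSum θ^[m] H (n / m) ω +
      birkhoffSum θ K m ((θ^[m])^[n / m] ω))) := by
  have h1 := CovBy.blocks hε hb hH (n / m) ω
  have h2 := CovBy.blocks hε hb hK (n % m) (θ^[m * (n / m)] ω)
  rw [one_mul] at h2
  have h3 := h1.mul hε hb h2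
  rw [Nat.div_add_mod, ← Real.exp_add] at h3
  -- As K ≥ 0, the n % m leftover steps may be replaced by m steps. The remainder is then one fixed
  -- function evaluated along the θ^m-orbit.
  refine h3.mono (Real.exp_le_exp.2 ?_)
  rw [Function.iterate_one, Function.iterate_mul]
  refine add_le_add le_rfl ?_
  exact Finset.sum_le_sum_of_subset_of_nonneg
    (Finset.range_subset_range.2 (Nat.mod_lt n hm).le) fun _ _ _ => hK0 _

/-- A separated set contains at most one point of each colour. -/
lemma CovBy.sum_le (h : CovBy T θ f n ω ε b s) {F : Finset X}
    (hF : IsSep T θ d n ω ε (F : Set X)) : ∑ x ∈ F, b ^ fibreSum T θ f n ω x ≤ s := by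
  classical
  obtain ⟨ι, _, c, w, h1, h2, h3, h4⟩ := h
  have hinj : Set.InjOn c F := fun x hx y hy hxy => by
    by_contra hne
    exact absurd (h2 x y hxy) (not_le.2 (hF x hx y hy hne))
  calc ∑ x ∈ F, b ^ fibreSum T θ f n ω x ≤ ∑ x ∈ F, w (c x) := Finset.sum_le_sum fun x _ => h3 x
    _ = ∑ i ∈ F.image c, w i := (Finset.sum_image hinj).symm
    _ ≤ ∑ i, w i := Finset.sum_le_univ_sum_of_nonneg h1
    _ ≤ s := h4

lemma CovBy.exists_card_le (h : CovBy T θ f n ω ε b s) :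
    ∃ N : ℕ, ∀ F : Finset X, IsSep T θ d n ω ε (F : Set X) → F.card ≤ N := by
  classical
  obtain ⟨ι, _, c, w, h1, h2, h3, h4⟩ := h
  refine ⟨Fintype.card ι, fun F hF => ?_⟩
  have hinj : Set.InjOn c F := fun x hx y hy hxy => by
    by_contra hne
    exact absurd (h2 x y hxy) (not_le.2 (hF x hx y hy hne))
  rw [← Finset.card_image_of_injOn hinj]
  exact Finset.card_le_univ _

lemma zero_mem_sepSums : (0 : ℝ) ∈ sepSums T θ f d n ω ε :=
  ⟨∅, by simp [IsSep], by simp⟩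

lemma CovBy.bddAbove (h : CovBy T θ f n ω ε (1 / ε) s) :
    BddAbove (sepSums T θ f d n ω ε) := by
  refine ⟨s, ?_⟩
  rintro _ ⟨F, hF, rfl⟩
  exact h.sum_le hF

lemma CovBy.sepP_le (h : CovBy T θ f n ω ε (1 / ε) s) :
    sepP T θ f d n ω ε ≤ s := by
  refine csSup_le ⟨0, zero_mem_sepSums⟩ ?_
  rintro _ ⟨F, hF, rfl⟩
  exact h.sum_le hF

variable [CompactSpace X]

lemma abs_fibreSum_le (n : ℕ) (ω : Ω) (x : X) :
    |fibreSum T θ f n ω x| ≤ birkhoffSum θ (fun ω => ‖f ω‖) n ω :=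
  (Finset.abs_sum_le_sum_abs _ _).trans
    (Finset.sum_le_sum fun j _ => (f (θ^[j] ω)).norm_coe_le_norm _)

/-- For some `C`, the sum `n C + log b ∑_{j < n} ‖f(θ^j ω)‖` bounds the logarithm of the separated
sums at scale `ε`. -/
theorem exists_covBy (T : FibreMaps Ω X) (θ : Ω → Ω) (f : Ω → C(X, ℝ)) {ε b : ℝ} (hε : 0 < ε)
    (hb : 1 < b) : ∃ C : ℝ, 0 ≤ C ∧ ∀ n ω,
      CovBy T θ f n ω ε b (Real.exp (birkhoffSum θ (fun ω => C + Real.log b * ‖f ω‖) n ω)) := by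
  obtain ⟨t, -, ht, hcov⟩ := finite_cover_balls_of_compact (isCompact_univ (X := X)) (half_pos hε)
  have := ht.fintype
  have hmem : ∀ x : X, ∃ y : t, dist x y < ε / 2 := fun x => by
    obtain ⟨y, hy, hxy⟩ := Set.mem_iUnion₂.1 (hcov (Set.mem_univ x))
    exact ⟨⟨y, hy⟩, hxy⟩
  choose c hc using hmem
  have hcard : (0 : ℝ) < Fintype.card t + 1 := by positivity
  -- The `+ 1` keeps the argument of the logarithm positive even for an empty cover.
  refine ⟨Real.log (Fintype.card t + 1), Real.log_nonneg (by simp), fun n ω => ?_⟩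
  have h1 : ∀ ω, CovBy T θ f 1 ω ε b
      (Real.exp (Real.log (Fintype.card t + 1) + Real.log b * ‖f ω‖)) := by
    intro ω
    refine ⟨t, inferInstance, c, fun _ => Real.exp (Real.log b * ‖f ω‖),
      fun _ => (Real.exp_pos _).le, ?_, ?_, ?_⟩
    · intro x y hxy
      rw [bowenDist_le_iff hε.le]
      intro j hj
      obtain rfl : j = 0 := by omega
      have h2 := hc x
      have h3 := hc y
      rw [← hxy] at h3
      change dist x y ≤ ε
      linarith [dist_triangle_right x y (c x)]
    · intro x
      rw [Real.rpow_def_of_pos (by positivity), Real.exp_le_exp]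
      refine mul_le_mul_of_nonneg_left ?_ (Real.log_nonneg hb.le)
      have h2 := (le_abs_self _).trans (abs_fibreSum_le (T := T) (θ := θ) (f := f) 1 ω x)
      rwa [birkhoffSum_one] at h2
    · rw [Finset.sum_const, Finset.card_univ, nsmul_eq_mul, Real.exp_add, Real.exp_log hcard]
      exact mul_le_mul_of_nonneg_right (by linarith) (Real.exp_pos _).le
  simpa using CovBy.blocks hε.le (by linarith) h1 n ω

/-- A maximal separated set at scale `ε` gives a colouring at scale `2 ε`. -/
theorem covBy_two_mul (hε : 0 < ε) (hε' : 2 * ε < 1) {V : Ω → ℝ}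
    (hV : ∀ ω x y, dist x y < 2 * ε → |f ω x - f ω y| ≤ V ω) (n : ℕ) (ω : Ω) :
    CovBy T θ f n ω (2 * ε) (1 / (2 * ε)) (sepP T θ f d n ω ε * Real.exp (birkhoffSum θ
      (fun ω => Real.log (1 / (2 * ε)) * V ω + Real.log 2 * ‖f ω‖) n ω)) := by
  classical
  have hb : 1 < 1 / ε := by rw [lt_div_iff₀ hε]; linarith
  have hb2 : 1 < 1 / (2 * ε) := by rw [lt_div_iff₀ (by positivity)]; linarith
  set G : Ω → ℝ := fun ω => Real.log (1 / (2 * ε)) * V ω + Real.log 2 * ‖f ω‖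
  obtain ⟨C, -, hC⟩ := exists_covBy T θ f hε hb
  obtain ⟨N, hN⟩ := (hC n ω).exists_card_le
  -- Maximal cardinality is obtained by minimising N - F.card.
  obtain ⟨F, hF, hmax⟩ : ∃ F : Finset X, IsSep T θ d n ω ε (F : Set X) ∧
      ∀ F' : Finset X, IsSep T θ d n ω ε (F' : Set X) → F'.card ≤ F.card := by
    have hex : ∃ k, ∃ F : Finset X, IsSep T θ d n ω ε (F : Set X) ∧ N - F.card = k :=
      ⟨_, ∅, by simp [IsSep], rfl⟩
    obtain ⟨F, hF, hk⟩ := Nat.find_spec hex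
    refine ⟨F, hF, fun F' hF' => ?_⟩
    have := Nat.find_min' hex ⟨F', hF', rfl⟩
    have := hN F hF
    have := hN F' hF'
    omega
  have hsymm : ∀ x y, bowenDist T θ d n ω x y = bowenDist T θ d n ω y x := fun x y => by
    simp only [bowenDist, dist_comm]
  have hspan : ∀ x, ∃ y : F, bowenDist T θ d n ω x y ≤ ε := by
    intro x
    by_contra! hcon
    have hxF : x ∉ F := fun hx => by
      refine absurd (hcon ⟨x, hx⟩) (not_lt.2 ((bowenDist_le_iff hε.le).2 fun j _ => ?_))
      rw [dist_self]
      exact hε.le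
    have hsep : IsSep T θ d n ω ε ((insert x F : Finset X) : Set X) := by
      intro y hy z hz hyz
      rw [Finset.coe_insert] at hy hz
      rcases hy with rfl | hy <;> rcases hz with rfl | hz
      · exact absurd rfl hyz
      · exact hcon ⟨z, hz⟩
      · rw [hsymm]; exact hcon ⟨y, hy⟩
      · exact hF y hy z hz hyz
    have := hmax _ hsep
    rw [Finset.card_insert_of_notMem hxF] at this
    omega
  choose c hc using hspan
  -- Colours are the points of F. The factor exp(∑ G) pays for two errors: moving from x to c x
  -- costs log(1/(2ε)) ∑ V, and changing the base from 1/(2ε) to 1/ε costs at most log 2 · ∑ ‖f‖.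
  refine ⟨F, inferInstance, c,
    fun y => (1 / ε) ^ fibreSum T θ f n ω y * Real.exp (birkhoffSum θ G n ω), fun y => ?_, ?_, ?_, ?_⟩
  · exact mul_nonneg (Real.rpow_nonneg (by positivity) _) (Real.exp_pos _).le
  · intro x y hxy
    rw [bowenDist_le_iff (by positivity)]
    intro j hj
    have h1 := (bowenDist_le_iff hε.le).1 (hc x) j hj
    have h2 := (bowenDist_le_iff hε.le).1 (hc y) j hj
    rw [← hxy] at h2
    linarith [dist_triangle_right (T.iter θ j ω x) (T.iter θ j ω y) (T.iter θ j ω (c x))]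
  · intro x
    set y : X := (c x : X)
    have hS : fibreSum T θ f n ω x - fibreSum T θ f n ω y ≤ birkhoffSum θ V n ω := by
      rw [fibreSum, fibreSum, ← Finset.sum_sub_distrib]
      refine Finset.sum_le_sum fun j hj => (le_abs_self _).trans (hV _ _ _ ?_)
      have := (bowenDist_le_iff hε.le).1 (hc x) j (Finset.mem_range.1 hj)
      linarith
    have hlog : Real.log (1 / (2 * ε)) = Real.log (1 / ε) - Real.log 2 := by
      rw [← Real.log_div (by positivity) (by norm_num)]
      congr 1
      field_simp
    have hG : birkhoffSum θ G n ω = Real.log (1 / (2 * ε)) * birkhoffSum θ V n ω +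
        Real.log 2 * birkhoffSum θ (fun ω => ‖f ω‖) n ω := by
      simp only [birkhoffSum, G, Finset.sum_add_distrib, Finset.mul_sum]
    have hneg := (abs_le.1 (abs_fibreSum_le (T := T) (θ := θ) (f := f) n ω y)).1
    change _ ≤ (1 / ε) ^ fibreSum T θ f n ω y * Real.exp (birkhoffSum θ G n ω)
    rw [Real.rpow_def_of_pos (by positivity), Real.rpow_def_of_pos (by positivity),
      ← Real.exp_add, Real.exp_le_exp, hG]
    have h1 := mul_le_mul_of_nonneg_left hS (Real.log_nonneg hb2.le)
    have h2 := mul_le_mul_of_nonneg_left hneg (Real.log_nonneg one_le_two)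
    rw [hlog] at h1 ⊢
    nlinarith
  · rw [← Finset.sum_mul]
    refine mul_le_mul_of_nonneg_right ?_ (Real.exp_pos _).le
    rw [Finset.sum_coe_sort F fun y => (1 / ε) ^ fibreSum T θ f n ω y]
    exact le_csSup ((hC n ω).bddAbove) ⟨F, hF, rfl⟩

variable [Nonempty X]

/-- A single point is separated, which bounds `P_n` below. -/
lemma exp_neg_birkhoffSum_le_sepP (hε : 0 < ε) (hε' : ε < 1) (n : ℕ) (ω : Ω) :
    Real.exp (-(Real.log (1 / ε) * birkhoffSum θ (fun ω => ‖f ω‖) n ω)) ≤ sepP T θ f d n ω ε := by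
  have hb : 1 < 1 / ε := by rw [lt_div_iff₀ hε]; linarith
  obtain ⟨C, -, hC⟩ := exists_covBy T θ f hε hb
  obtain ⟨x⟩ := ‹Nonempty X›
  refine le_trans ?_ (le_csSup ((hC n ω).bddAbove) ⟨{x}, ?_, rfl⟩)
  · rw [Finset.sum_singleton, Real.rpow_def_of_pos (by positivity), Real.exp_le_exp, ← mul_neg]
    exact mul_le_mul_of_nonneg_left (abs_le.1 (abs_fibreSum_le n ω x)).1 (Real.log_nonneg hb.le)
  · intro y hy z hz hyz
    simp only [Finset.coe_singleton, Set.mem_singleton_iff] at hy hz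
    exact absurd (hy.trans hz.symm) hyz

lemma sepP_pos (hε : 0 < ε) (hε' : ε < 1) (n : ℕ) (ω : Ω) : 0 < sepP T θ f d n ω ε :=
  (Real.exp_pos _).trans_le (exp_neg_birkhoffSum_le_sepP hε hε' n ω)

end Colouring

/-! ### Measurability of the separated sums in ω -/

section Measurability

variable {Ω : Type*} {X : Type u} [MeasurableSpace Ω] [d : MetricSpace X]
  [MeasurableSpace X] {T : FibreMaps Ω X} {θ : Ω → Ω} {f : Ω → C(X, ℝ)}

lemma measurable_iter (hθ : Measurable θ) (n : ℕ) :
    Measurable fun p : Ω × X => T.iter θ n p.1 p.2 := by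
  induction n with
  | zero => exact measurable_snd
  | succ n ih =>
    exact T.measurable_map.comp (((hθ.iterate n).comp measurable_fst).prodMk ih)

lemma measurable_iter_left (hθ : Measurable θ) (n : ℕ) (x : X) :
    Measurable fun ω => T.iter θ n ω x :=
  (measurable_iter hθ n).comp measurable_prodMk_right

lemma measurable_fibreSum (hθ : Measurable θ) (hf : Measurable fun p : Ω × X => f p.1 p.2) (n : ℕ)
    (x : X) : Measurable fun ω => fibreSum T θ f n ω x :=
  Finset.measurable_sum _ fun j _ =>
    hf.comp ((hθ.iterate j).prodMk (measurable_iter_left hθ j x))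

/-- Separated sums can be approximated by those over subsets of a dense set. -/
lemma exists_isSep_subset_dense {D : Set X} (hD : Dense D) {ε b : ℝ} (hε : 0 ≤ ε) (hb : 0 < b)
    {n : ℕ} {ω : Ω} {F : Finset X} (hF : IsSep T θ d n ω ε (F : Set X)) {s : ℝ}
    (hs : s < ∑ x ∈ F, b ^ fibreSum T θ f n ω x) :
    ∃ F' : Finset D, IsSep T θ d n ω ε (F'.map (Function.Embedding.subtype _) : Finset X) ∧
      s < ∑ x ∈ F'.map (Function.Embedding.subtype _), b ^ fibreSum T θ f n ω x := by
  classical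
  -- Both requirements are strict inequalities between continuous functions of the tuple, so they
  -- define an open set, which meets the dense set of tuples from D.
  set U : Set (F → X) := {v | (∀ i j : F, i ≠ j → ε < bowenDist T θ d n ω (v i) (v j)) ∧
    s < ∑ i, b ^ fibreSum T θ f n ω (v i)} with hU
  have hUo : IsOpen U := by
    have h1 : U = (⋂ i : F, ⋂ j : F, {v | i ≠ j → ε < bowenDist T θ d n ω (v i) (v j)}) ∩
        {v | s < ∑ i, b ^ fibreSum T θ f n ω (v i)} := by
      ext v
      simp [hU]
    rw [h1]
    refine IsOpen.inter (isOpen_iInter_of_finite fun i => isOpen_iInter_of_finite fun j => ?_) ?_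
    · by_cases hij : i = j
      · simp [hij]
      · have hc : Continuous fun v : F → X => bowenDist T θ d n ω (v i) (v j) :=
          (continuous_bowenDist n ω).comp (f := fun v : F → X => (v i, v j)) ((continuous_apply i).prodMk (continuous_apply j))
        simpa [hij] using isOpen_lt continuous_const hc
    · refine isOpen_lt continuous_const (continuous_finsetSum _ fun i _ => ?_)
      exact continuous_const.rpow ((continuous_fibreSum n ω).comp (continuous_apply i))
        fun _ => Or.inl hb.ne'
  have hne : U.Nonempty := by
    refine ⟨fun i => i, fun i j hij => hF i i.2 j j.2 fun h => hij (Subtype.ext h), ?_⟩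
    rwa [Finset.sum_coe_sort F fun x => b ^ fibreSum T θ f n ω x]
  obtain ⟨v, hvU, hvD⟩ := (dense_pi Set.univ fun (_ : F) _ => hD).inter_open_nonempty U hUo hne
  have hvi : Function.Injective v := fun i j hij => by
    by_contra hne
    have := hvU.1 i j hne
    rw [hij, bowenDist_self] at this
    linarith
  have hmap : (Finset.univ.image fun i : F => (⟨v i, hvD i trivial⟩ : D)).map
      (Function.Embedding.subtype _) = Finset.univ.image v := by
    ext x
    simp only [Finset.mem_map, Finset.mem_image, Finset.mem_univ, true_and]
    constructor
    · rintro ⟨_, ⟨i, rfl⟩, rfl⟩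
      exact ⟨i, rfl⟩
    · rintro ⟨i, rfl⟩
      exact ⟨_, ⟨i, rfl⟩, rfl⟩
  refine ⟨Finset.univ.image fun i : F => ⟨v i, hvD i trivial⟩, ?_, ?_⟩
  · rw [hmap]
    intro x hx y hy hxy
    simp only [Finset.coe_image, Finset.coe_univ, Set.image_univ, Set.mem_range] at hx hy
    obtain ⟨i, rfl⟩ := hx
    obtain ⟨j, rfl⟩ := hy
    exact hvU.1 i j fun h => hxy (congrArg v h)
  · rw [hmap, Finset.sum_image hvi.injOn]
    exact hvU.2

variable [CompactSpace X] [BorelSpace X]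

lemma measurable_bowenDist (hθ : Measurable θ) (n : ℕ) (x y : X) :
    Measurable fun ω => bowenDist T θ d n ω x y :=
  Measurable.iSup fun j =>
    (measurable_iter_left hθ (j : ℕ) x).dist (measurable_iter_left hθ (j : ℕ) y)

lemma measurableSet_isSep (hθ : Measurable θ) (n : ℕ) (ε : ℝ) (F : Finset X) :
    MeasurableSet {ω | IsSep T θ d n ω ε (F : Set X)} := by
  have : {ω | IsSep T θ d n ω ε (F : Set X)} =
      ⋂ x ∈ F, ⋂ y ∈ F, {ω | x ≠ y → ε < bowenDist T θ d n ω x y} := by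
    ext ω
    simp [IsSep]
  rw [this]
  refine Finset.measurableSet_biInter _ fun x _ => Finset.measurableSet_biInter _ fun y _ => ?_
  by_cases hxy : x = y
  · simp [hxy]
  · simpa [hxy] using measurableSet_lt measurable_const (measurable_bowenDist hθ n x y)

/-- The supremum reduces to the countably many finite subsets of a countable dense set. Where such a
subset is not separated, the indicator gives 0, the sum over the empty set, hence still an
admissible value. -/
theorem measurable_sepP (hθ : Measurable θ) (hf : Measurable fun p : Ω × X => f p.1 p.2) {ε : ℝ}
    (hε : 0 < ε) (hε' : ε < 1) (n : ℕ) : Measurable fun ω => sepP T θ f d n ω ε := by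
  classical
  obtain ⟨D, hDc, hD⟩ := TopologicalSpace.exists_countable_dense X
  have := hDc.to_subtype
  have hb : 1 < 1 / ε := by rw [lt_div_iff₀ hε]; linarith
  obtain ⟨C, -, hC⟩ := exists_covBy T θ f hε hb
  set Φ : Finset D → Ω → ℝ := fun F => Set.indicator
    {ω | IsSep T θ d n ω ε (F.map (Function.Embedding.subtype _) : Finset X)}
    (fun ω => ∑ x ∈ F.map (Function.Embedding.subtype _), (1 / ε) ^ fibreSum T θ f n ω x)
  have hmem : ∀ F ω, Φ F ω ∈ sepSums T θ f d n ω ε := by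
    intro F ω
    by_cases h : ω ∈ {ω | IsSep T θ d n ω ε (F.map (Function.Embedding.subtype _) : Finset X)}
    · exact ⟨_, h, Set.indicator_of_mem h _⟩
    · simp only [Φ, Set.indicator_of_notMem h]
      exact zero_mem_sepSums
  have heq : (fun ω => sepP T θ f d n ω ε) = fun ω => ⨆ F, Φ F ω := by
    ext ω
    have hbdd := (hC n ω).bddAbove
    refine le_antisymm ?_ (ciSup_le fun F => le_csSup hbdd (hmem F ω))
    refine csSup_le ⟨0, zero_mem_sepSums⟩ ?_
    rintro _ ⟨F, hF, rfl⟩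
    refine le_of_forall_lt fun s hs => ?_
    obtain ⟨F', hF', hs'⟩ := exists_isSep_subset_dense hD hε.le (by positivity) hF hs
    refine hs'.trans_le ?_
    rw [← Set.indicator_of_mem (s := {ω | IsSep T θ d n ω ε
      (F'.map (Function.Embedding.subtype _) : Finset X)}) hF' (fun ω =>
        ∑ x ∈ F'.map (Function.Embedding.subtype _), (1 / ε) ^ fibreSum T θ f n ω x)]
    refine le_ciSup (f := fun F => Φ F ω) (hbdd.mono ?_) F'
    rintro _ ⟨F, rfl⟩
    exact hmem F ω
  rw [heq]
  refine Measurable.iSup fun F => Measurable.indicator ?_ (measurableSet_isSep hθ n ε _)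
  exact Finset.measurable_sum _ fun x _ => (measurable_fibreSum hθ hf n x).const_pow _

end Measurability

/-! ### Oscillation of the potential at small scales -/

section Oscillation

variable {Ω : Type*} {X : Type u} [MetricSpace X] [CompactSpace X] {f : Ω → C(X, ℝ)}

lemma abs_sub_le_two_mul_norm (ω : Ω) (x y : X) : |f ω x - f ω y| ≤ 2 * ‖f ω‖ := by
  have h1 := (f ω).norm_coe_le_norm x
  have h2 := (f ω).norm_coe_le_norm y
  rw [Real.norm_eq_abs] at h1 h2
  linarith [abs_sub (f ω x) (f ω y)]

variable [Nonempty X]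

/-- The oscillation `sup {|f(ω, x) - f(ω, y)| : d(x, y) < r}`, over a dense sequence of points. -/
def osc (f : Ω → C(X, ℝ)) (r : ℝ) (ω : Ω) : ℝ :=
  ⨆ p : ℕ × ℕ, if dist (TopologicalSpace.denseSeq X p.1) (TopologicalSpace.denseSeq X p.2) < r then
    |f ω (TopologicalSpace.denseSeq X p.1) - f ω (TopologicalSpace.denseSeq X p.2)| else 0

lemma osc_le {r c : ℝ} {ω : Ω} (hc : 0 ≤ c)
    (h : ∀ x y, dist x y < r → |f ω x - f ω y| ≤ c) : osc f r ω ≤ c := by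
  refine ciSup_le fun p => ?_
  split_ifs with hp
  · exact h _ _ hp
  · exact hc

lemma osc_le_two_mul_norm (r : ℝ) (ω : Ω) : osc f r ω ≤ 2 * ‖f ω‖ :=
  osc_le (by positivity) fun x y _ => abs_sub_le_two_mul_norm ω x y

lemma osc_nonneg (r : ℝ) (ω : Ω) : 0 ≤ osc f r ω :=
  Real.iSup_nonneg fun p => by split_ifs <;> positivity

/-- A violation would be an open condition on the pair, thanks to the strict `dist x y < r`, and so
would occur at points of the dense sequence. -/
lemma abs_sub_le_osc {r : ℝ} (ω : Ω) {x y : X} (hxy : dist x y < r) :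
    |f ω x - f ω y| ≤ osc f r ω := by
  by_contra! hcon
  have hopen : IsOpen {p : X × X | dist p.1 p.2 < r ∧ osc f r ω < |f ω p.1 - f ω p.2|} :=
    (isOpen_lt continuous_dist continuous_const).inter
      (isOpen_lt continuous_const ((((f ω).continuous.comp continuous_fst).sub
        ((f ω).continuous.comp continuous_snd)).abs))
  have hd : DenseRange (Prod.map (TopologicalSpace.denseSeq X) (TopologicalSpace.denseSeq X)) :=
    (TopologicalSpace.denseRange_denseSeq X).prodMap (TopologicalSpace.denseRange_denseSeq X)
  obtain ⟨p, hp1, hp2⟩ := hd.exists_mem_open hopen ⟨(x, y), hxy, hcon⟩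
  refine absurd hp2 (not_lt.2 ?_)
  refine le_trans ?_ (le_ciSup (f := fun p : ℕ × ℕ =>
    if dist (TopologicalSpace.denseSeq X p.1) (TopologicalSpace.denseSeq X p.2) < r then
    |f ω (TopologicalSpace.denseSeq X p.1) - f ω (TopologicalSpace.denseSeq X p.2)| else 0) ?_ p)
  · exact le_of_eq (if_pos hp1).symm
  · refine ⟨2 * ‖f ω‖, ?_⟩
    rintro _ ⟨q, rfl⟩
    dsimp only
    split_ifs
    · exact abs_sub_le_two_mul_norm ω _ _
    · positivity

/-- The excess in comparing growth at scale `2 ε` with pressure at scale `ε`. -/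
def scaleExcess (f : Ω → C(X, ℝ)) (ε : ℝ) (ω : Ω) : ℝ :=
  Real.log (1 / (2 * ε)) * osc f (2 * ε) ω + Real.log 2 * ‖f ω‖

lemma scaleExcess_def (f : Ω → C(X, ℝ)) (ε : ℝ) : scaleExcess f ε =
    fun ω => Real.log (1 / (2 * ε)) * osc f (2 * ε) ω + Real.log 2 * ‖f ω‖ := rfl

lemma tendsto_osc (ω : Ω) : Tendsto (fun r => osc f r ω) (𝓝[>] 0) (𝓝 0) := by
  rw [Metric.tendsto_nhds]
  intro δ hδ
  obtain ⟨η, hη, h⟩ := Metric.uniformContinuous_iff.1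
    (CompactSpace.uniformContinuous_of_continuous (f ω).continuous) (δ / 2) (half_pos hδ)
  filter_upwards [Ioo_mem_nhdsGT hη] with r hr
  rw [Real.dist_eq, sub_zero, abs_of_nonneg (osc_nonneg r ω)]
  refine lt_of_le_of_lt (osc_le (half_pos hδ).le fun x y hxy => ?_) (half_lt_self hδ)
  exact (h (hxy.trans hr.2)).le

variable [MeasurableSpace Ω] [MeasurableSpace X]

lemma measurable_osc (hf : Measurable fun p : Ω × X => f p.1 p.2) (r : ℝ) :
    Measurable (osc f r) := by
  refine Measurable.iSup fun p => ?_
  have h : ∀ x, Measurable fun ω => f ω x := fun x => hf.comp measurable_prodMk_right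
  split_ifs
  · have := (h (TopologicalSpace.denseSeq X p.1)).sub (h (TopologicalSpace.denseSeq X p.2))
    exact this.abs
  · exact measurable_const

variable {P : Measure Ω}

lemma integrable_osc (hf : MemL1C P f) (r : ℝ) : Integrable (osc f r) P := by
  refine (hf.integrable_norm.const_mul 2).mono'
    (measurable_osc hf.measurable r).aestronglyMeasurable (Eventually.of_forall fun ω => ?_)
  rw [Real.norm_eq_abs, abs_of_nonneg (osc_nonneg r ω)]
  exact osc_le_two_mul_norm r ω

lemma integrable_scaleExcess (hf : MemL1C P f) (ε : ℝ) : Integrable (scaleExcess f ε) P :=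
  ((integrable_osc hf _).const_mul _).add (hf.integrable_norm.const_mul _)

lemma tendsto_integral_osc (hf : MemL1C P f) :
    Tendsto (fun r => ∫ ω, osc f r ω ∂P) (𝓝[>] 0) (𝓝 0) := by
  have h := tendsto_integral_filter_of_dominated_convergence (μ := P) (l := 𝓝[>] (0 : ℝ))
    (F := fun r => osc f r) (f := fun _ => 0) (fun ω => 2 * ‖f ω‖)
    (Eventually.of_forall fun r => (integrable_osc hf r).aestronglyMeasurable)
    (Eventually.of_forall fun r => Eventually.of_forall fun ω => by
      rw [Real.norm_eq_abs, abs_of_nonneg (osc_nonneg r ω)]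
      exact osc_le_two_mul_norm r ω)
    (hf.integrable_norm.const_mul 2) (Eventually.of_forall tendsto_osc)
  simpa using h

end Oscillation

/-- Each g(θ^n x) is a difference of consecutive Birkhoff sums, whose averages share one finite
limit. -/
lemma ae_tendsto_comp_iterate_div {α : Type*} [MeasurableSpace α] {μ : Measure α}
    [IsFiniteMeasure μ] {θ : α → α} {g : α → ℝ} (hθ : MeasurePreserving θ μ μ)
    (hg : Integrable g μ) :
    ∀ᵐ x ∂μ, Tendsto (fun n : ℕ => g (θ^[n] x) / n) atTop (𝓝 0) := by
  filter_upwards [ae_tendsto_birkhoffSum_div hθ hg] with x hx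
  have h1 := (hx.comp (tendsto_add_atTop_nat 1)).mul
    (tendsto_const_nhds.add tendsto_one_div_atTop_nhds_zero_nat :
      Tendsto (fun n : ℕ => (1 : ℝ) + 1 / n) atTop (𝓝 (1 + 0)))
  have h2 := h1.sub hx
  rw [add_zero, mul_one, sub_self] at h2
  refine h2.congr' ?_
  filter_upwards [eventually_gt_atTop 0] with n hn
  have hn' : (n : ℝ) ≠ 0 := Nat.cast_ne_zero.2 hn.ne'
  have hn1 : (n : ℝ) + 1 ≠ 0 := by positivity
  simp only [Function.comp_apply, birkhoffSum_succ]
  push_cast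
  field_simp
  ring

lemma tendsto_natDiv_div {m : ℕ} (hm : 0 < m) :
    Tendsto (fun n : ℕ => ((n / m : ℕ) : ℝ) / n) atTop (𝓝 (1 / m)) := by
  have h := (tendsto_nat_floor_mul_div_atTop (R := ℝ) (a := 1 / (m : ℝ)) (by positivity)).comp
    tendsto_natCast_atTop_atTop
  refine h.congr fun n => ?_
  simp only [Function.comp_apply]
  rw [one_div_mul_eq_div, Nat.floor_div_eq_div]

/-! ### Fibrewise growth against pressure -/

section Growth

variable {Ω : Type*} {X : Type u} [MeasurableSpace Ω] [d : MetricSpace X]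
  [MeasurableSpace X] {T : FibreMaps Ω X} {θ : Ω → Ω}
  {f : Ω → C(X, ℝ)} {P : Measure Ω} {ε : ℝ}

lemma fibreGrowth_le_of_tendsto {ω : Ω} {R : ℕ → ℝ} {r : ℝ} (hR : Tendsto R atTop (𝓝 r))
    (h : ∀ᶠ n : ℕ in atTop, 1 / (n : ℝ) * Real.log (sepP T θ f d n ω ε) ≤ R n) :
    fibreGrowth T θ f d ε ω ≤ r := by
  have hlim : Tendsto (fun n => (R n : EReal)) atTop (𝓝 (r : EReal)) :=
    (continuous_coe_real_ereal.tendsto r).comp hR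
  rw [← hlim.limsup_eq]
  exact limsup_le_limsup (h.mono fun n hn => EReal.coe_le_coe_iff.2 hn)

variable [CompactSpace X]

lemma measurable_fibreGrowth [BorelSpace X] (hθ : Measurable θ) (hf : MemL1C P f) (hε : 0 < ε) (hε' : ε < 1) :
    Measurable (fibreGrowth T θ f d ε) :=
  Measurable.limsup fun n =>
    ((measurable_sepP hθ hf.measurable hε hε' n).log.const_mul _).coe_real_ereal

variable [Nonempty X]

lemma exists_abs_log_sepP_le (T : FibreMaps Ω X) (θ : Ω → Ω) (f : Ω → C(X, ℝ)) (hε : 0 < ε)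
    (hε' : ε < 1) : ∃ C : ℝ, ∀ n ω, |Real.log (sepP T θ f d n ω ε)| ≤
      birkhoffSum θ (fun ω => C + Real.log (1 / ε) * ‖f ω‖) n ω := by
  have hb : 1 < 1 / ε := by rw [lt_div_iff₀ hε]; linarith
  obtain ⟨C, hC0, hC⟩ := exists_covBy T θ f hε hb
  refine ⟨C, fun n ω => abs_le.2 ⟨?_, ?_⟩⟩
  · have h1 := exp_neg_birkhoffSum_le_sepP (T := T) (θ := θ) (f := f) hε hε' n ω
    have h2 := (Real.le_log_iff_exp_le (sepP_pos hε hε' n ω)).2 h1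
    refine le_trans (neg_le_neg ?_) h2
    rw [birkhoffSum, Finset.mul_sum]
    exact Finset.sum_le_sum fun j _ => by linarith
  · exact (Real.log_le_iff_le_exp (sepP_pos hε hε' n ω)).2 (hC n ω).sepP_le

variable [IsProbabilityMeasure P]

lemma exists_ae_fibreGrowth_mem_Icc (hθ : MeasurePreserving θ P P) (hf : MemL1C P f)
    (hε : 0 < ε) (hε' : ε < 1) : ∃ K : Ω → ℝ, Integrable K P ∧
      ∀ᵐ ω ∂P, fibreGrowth T θ f d ε ω ∈ Set.Icc ((-K ω : ℝ) : EReal) (K ω) := by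
  obtain ⟨C, hC⟩ := exists_abs_log_sepP_le T θ f hε hε'
  have hK : Integrable (fun ω => C + Real.log (1 / ε) * ‖f ω‖) P :=
    (integrable_const C).add (hf.integrable_norm.const_mul _)
  refine ⟨P[fun ω => C + Real.log (1 / ε) * ‖f ω‖ | MeasurableSpace.invariants θ],
    integrable_condExp, ?_⟩
  filter_upwards [ae_tendsto_birkhoffSum_div hθ hK] with ω hω
  have hle : ∀ n : ℕ, |1 / (n : ℝ) * Real.log (sepP T θ f d n ω ε)| ≤
      birkhoffSum θ (fun ω => C + Real.log (1 / ε) * ‖f ω‖) n ω / n := fun n => by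
    rw [abs_mul, abs_of_nonneg (by positivity), one_div_mul_eq_div]
    exact div_le_div_of_nonneg_right (hC n ω) (Nat.cast_nonneg n)
  constructor
  · have hlim := (continuous_coe_real_ereal.tendsto _).comp hω.neg
    rw [← hlim.limsup_eq]
    exact limsup_le_limsup (Eventually.of_forall fun n =>
      EReal.coe_le_coe_iff.2 (abs_le.1 (hle n)).1)
  · exact fibreGrowth_le_of_tendsto hω (Eventually.of_forall fun n => (abs_le.1 (hle n)).2)

theorem ae_fibreGrowth_ne (hθ : MeasurePreserving θ P P) (hf : MemL1C P f)
    (hε : 0 < ε) (hε' : ε < 1) :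
    ∀ᵐ ω ∂P, fibreGrowth T θ f d ε ω ≠ ⊤ ∧ fibreGrowth T θ f d ε ω ≠ ⊥ := by
  obtain ⟨K, -, h⟩ := exists_ae_fibreGrowth_mem_Icc (T := T) hθ hf hε hε'
  filter_upwards [h] with ω hω
  exact ⟨(hω.2.trans_lt (EReal.coe_lt_top _)).ne, ((EReal.bot_lt_coe _).trans_le hω.1).ne'⟩

variable [BorelSpace X]

theorem integrable_log_sepP (hθ : MeasurePreserving θ P P) (hf : MemL1C P f) (hε : 0 < ε)
    (hε' : ε < 1) (n : ℕ) : Integrable (fun ω => Real.log (sepP T θ f d n ω ε)) P := by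
  obtain ⟨C, hC⟩ := exists_abs_log_sepP_le T θ f hε hε'
  have hK : Integrable (fun ω => C + Real.log (1 / ε) * ‖f ω‖) P :=
    (integrable_const C).add (hf.integrable_norm.const_mul _)
  exact (integrable_birkhoffSum hθ hK n).mono'
    (measurable_sepP hθ.measurable hf.measurable hε hε' n).log.aestronglyMeasurable
    (Eventually.of_forall (hC n))

theorem integrable_toReal_fibreGrowth (hθ : MeasurePreserving θ P P) (hf : MemL1C P f)
    (hε : 0 < ε) (hε' : ε < 1) :
    Integrable (fun ω => (fibreGrowth T θ f d ε ω).toReal) P := by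
  obtain ⟨K, hK, h⟩ := exists_ae_fibreGrowth_mem_Icc (T := T) hθ hf hε hε'
  refine hK.mono'
    (measurable_fibreGrowth hθ.measurable hf hε hε').ereal_toReal.aestronglyMeasurable ?_
  filter_upwards [h, ae_fibreGrowth_ne (T := T) hθ hf hε hε'] with ω hω hne
  rw [← EReal.coe_toReal hne.1 hne.2] at hω
  exact abs_le.2 ⟨EReal.coe_le_coe_iff.1 hω.1, EReal.coe_le_coe_iff.1 hω.2⟩

theorem pressure_le_integral_fibreGrowth (hθ : MeasurePreserving θ P P) (hf : MemL1C P f)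
    (hε : 0 < ε) (hε' : ε < 1) :
    pressure P T θ f d ε ≤ ((∫ ω, (fibreGrowth T θ f d ε ω).toReal ∂P : ℝ) : EReal) := by
  obtain ⟨C, hC⟩ := exists_abs_log_sepP_le T θ f hε hε'
  set K : Ω → ℝ := fun ω => C + Real.log (1 / ε) * ‖f ω‖
  have hK : Integrable K P := (integrable_const C).add (hf.integrable_norm.const_mul _)
  have hLint : Tendsto (fun n : ℕ => ∫ ω, birkhoffSum θ K n ω / n ∂P) atTop
      (𝓝 (∫ ω, (P[K | MeasurableSpace.invariants θ]) ω ∂P)) := by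
    rw [integral_condExp (MeasurableSpace.invariants_le θ)]
    refine tendsto_const_nhds.congr' ?_
    filter_upwards [eventually_gt_atTop 0] with n hn
    rw [integral_div, integral_birkhoffSum hθ hK,
      mul_div_cancel_left₀ _ (Nat.cast_ne_zero.2 hn.ne')]
  have hGa : ∀ᵐ ω ∂P, ∀ δ > 0, ∀ᶠ n : ℕ in atTop,
      1 / (n : ℝ) * Real.log (sepP T θ f d n ω ε) < (fibreGrowth T θ f d ε ω).toReal + δ := by
    filter_upwards [ae_fibreGrowth_ne (T := T) hθ hf hε hε'] with ω hω δ hδ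
    have hlt : fibreGrowth T θ f d ε ω <
        (((fibreGrowth T θ f d ε ω).toReal + δ : ℝ) : EReal) := by
      conv_lhs => rw [← EReal.coe_toReal hω.1 hω.2]
      exact EReal.coe_lt_coe_iff.2 (lt_add_of_pos_right _ hδ)
    exact (eventually_lt_of_limsup_lt hlt).mono fun n hn => EReal.coe_lt_coe_iff.1 hn
  refine EReal.le_of_forall_lt_iff_le.1 fun z hz => ?_
  have hev := eventually_integral_lt_of_dominated (μ := P)
    (a := fun n ω => 1 / (n : ℝ) * Real.log (sepP T θ f d n ω ε))
    (L := fun n ω => birkhoffSum θ K n ω / n)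
    (fun n => (integrable_log_sepP hθ hf hε hε' n).const_mul _)
    (fun n => (integrable_birkhoffSum hθ hK n).div_const _)
    (fun n ω => by
      rw [one_div_mul_eq_div]
      exact div_le_div_of_nonneg_right ((le_abs_self _).trans (hC n ω)) (Nat.cast_nonneg n))
    (ae_tendsto_birkhoffSum_div hθ hK) integrable_condExp hLint
    (integrable_toReal_fibreGrowth hθ hf hε hε') hGa (sub_pos.2 (EReal.coe_lt_coe_iff.1 hz))
  refine limsup_le_of_le (by isBoundedDefault) ?_
  filter_upwards [hev] with n hn
  rw [integral_const_mul, add_sub_cancel] at hn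
  exact EReal.coe_le_coe_iff.2 hn.le

/-- A block of length m costs H = log P_m(ε) plus the summed excess. Birkhoff's theorem for θ^m
averages H over the blocks, and the incomplete last block is negligible. -/
theorem integral_fibreGrowth_two_mul_le (hθ : MeasurePreserving θ P P) (hf : MemL1C P f)
    (hε : 0 < ε) (hε' : 2 * ε < 1) {m : ℕ} (hm : 0 < m) :
    ∫ ω, (fibreGrowth T θ f d (2 * ε) ω).toReal ∂P ≤
      1 / (m : ℝ) * ∫ ω, Real.log (sepP T θ f d m ω ε) ∂P + ∫ ω, scaleExcess f ε ω ∂P := by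
  have hε1 : ε < 1 := by linarith
  have h2ε : 0 < 2 * ε := by positivity
  have hb : 1 < 1 / (2 * ε) := by rw [lt_div_iff₀ h2ε]; linarith
  obtain ⟨C, hC0, hC⟩ := exists_covBy T θ f h2ε hb
  set K : Ω → ℝ := fun ω => C + Real.log (1 / (2 * ε)) * ‖f ω‖
  have hK : Integrable K P := (integrable_const C).add (hf.integrable_norm.const_mul _)
  have hK0 : ∀ ω, 0 ≤ K ω := fun ω =>
    add_nonneg hC0 (mul_nonneg (Real.log_nonneg hb.le) (norm_nonneg _))
  set H : Ω → ℝ := fun ω => Real.log (sepP T θ f d m ω ε) + birkhoffSum θ (scaleExcess f ε) m ω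
  have hH : Integrable H P := (integrable_log_sepP hθ hf hε hε1 m).add
    (integrable_birkhoffSum hθ (integrable_scaleExcess hf ε) m)
  have hcovH : ∀ ω, CovBy T θ f m ω (2 * ε) (1 / (2 * ε)) (Real.exp (H ω)) := fun ω => by
    have h := covBy_two_mul (T := T) (θ := θ) hε hε'
      (fun ω x y hxy => abs_sub_le_osc (f := f) ω hxy) m ω
    rwa [← scaleExcess_def, ← Real.exp_log (sepP_pos hε hε1 m ω), ← Real.exp_add] at h
  have hcovK : ∀ ω, CovBy T θ f 1 ω (2 * ε) (1 / (2 * ε)) (Real.exp (K ω)) := fun ω => by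
    simpa only [birkhoffSum_one] using hC 1 ω
  have hθm : MeasurePreserving θ^[m] P P := hθ.iterate m
  have hdiv : Tendsto (fun n : ℕ => n / m) atTop atTop :=
    Nat.tendsto_div_const_atTop hm.ne'
  have hae : ∀ᵐ ω ∂P, fibreGrowth T θ f d (2 * ε) ω ≤
      (((P[H | MeasurableSpace.invariants θ^[m]]) ω * (1 / (m : ℝ)) : ℝ) : EReal) := by
    filter_upwards [ae_tendsto_birkhoffSum_div hθm hH,
      ae_tendsto_comp_iterate_div hθm (integrable_birkhoffSum hθ hK m)] with ω h1 h2
    -- Averages over the n / m blocks become averages over n steps through the factor (n / m) / n,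
    -- which tends to 1 / m.
    have hlim := ((h1.add h2).comp hdiv).mul (tendsto_natDiv_div hm)
    rw [add_zero] at hlim
    refine fibreGrowth_le_of_tendsto hlim ?_
    filter_upwards [eventually_ge_atTop m] with n hn
    have hq : ((n / m : ℕ) : ℝ) ≠ 0 := Nat.cast_ne_zero.2 (Nat.div_pos hn hm).ne'
    have h3 := (CovBy.blocks_add h2ε.le (by linarith) hcovH hcovK hK0 hm n ω).sepP_le
    have h4 := (Real.log_le_iff_le_exp (sepP_pos h2ε hε' n ω)).2 h3
    simp only [Function.comp_apply]
    rw [← add_div, div_mul_div_cancel₀ hq, one_div_mul_eq_div]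
    exact div_le_div_of_nonneg_right h4 (Nat.cast_nonneg n)
  calc ∫ ω, (fibreGrowth T θ f d (2 * ε) ω).toReal ∂P
      ≤ ∫ ω, (P[H | MeasurableSpace.invariants θ^[m]]) ω * (1 / (m : ℝ)) ∂P := by
        refine integral_mono_ae (integrable_toReal_fibreGrowth hθ hf h2ε hε')
          (integrable_condExp.mul_const _) ?_
        filter_upwards [hae, ae_fibreGrowth_ne (T := T) hθ hf h2ε hε'] with ω h1 h2
        rw [← EReal.coe_toReal h2.1 h2.2] at h1
        exact EReal.coe_le_coe_iff.1 h1
    _ = (∫ ω, Real.log (sepP T θ f d m ω ε) ∂P + m * ∫ ω, scaleExcess f ε ω ∂P) *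
          (1 / (m : ℝ)) := by
        rw [integral_mul_const, integral_condExp (MeasurableSpace.invariants_le _),
          integral_add (integrable_log_sepP hθ hf hε hε1 m)
            (integrable_birkhoffSum hθ (integrable_scaleExcess hf ε) m),
          integral_birkhoffSum hθ (integrable_scaleExcess hf ε)]
    _ = _ := by
        have : (m : ℝ) ≠ 0 := Nat.cast_ne_zero.2 hm.ne'
        field_simp

theorem integral_fibreGrowth_two_mul_le_pressure (hθ : MeasurePreserving θ P P)
    (hf : MemL1C P f) (hε : 0 < ε) (hε' : 2 * ε < 1) :
    ((∫ ω, (fibreGrowth T θ f d (2 * ε) ω).toReal ∂P - ∫ ω, scaleExcess f ε ω ∂P : ℝ) : EReal) ≤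
      pressure P T θ f d ε := by
  refine le_limsup_of_frequently_le' (Eventually.frequently ?_)
  filter_upwards [eventually_gt_atTop 0] with m hm
  refine EReal.coe_le_coe_iff.2 ?_
  linarith [integral_fibreGrowth_two_mul_le (T := T) hθ hf hε hε' hm]

lemma coe_toReal_pressure (hθ : MeasurePreserving θ P P) (hf : MemL1C P f) (hε : 0 < ε)
    (hε' : 2 * ε < 1) : (((pressure P T θ f d ε).toReal : ℝ) : EReal) = pressure P T θ f d ε :=
  EReal.coe_toReal
    ((pressure_le_integral_fibreGrowth hθ hf hε (by linarith)).trans_lt (EReal.coe_lt_top _)).ne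
    ((EReal.bot_lt_coe _).trans_le (integral_fibreGrowth_two_mul_le_pressure hθ hf hε hε')).ne'

lemma tendsto_log_one_div : Tendsto (fun ε : ℝ => Real.log (1 / ε)) (𝓝[>] 0) atTop := by
  simp only [one_div, Real.log_inv]
  exact tendsto_neg_atBot_atTop.comp Real.tendsto_log_nhdsGT_zero

/-- The metric mean dimensions are the upper and lower limits of the normalised mean fibrewise
growth rates. -/
theorem mdim_eq (hθ : MeasurePreserving θ P P) (hf : MemL1C P f) :
    upperMdim P T θ f d = limsup (fun ε : ℝ => (((1 / Real.log (1 / ε)) *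
        ∫ ω, (fibreGrowth T θ f d ε ω).toReal ∂P : ℝ) : EReal)) (𝓝[>] 0) ∧
    lowerMdim P T θ f d = liminf (fun ε : ℝ => (((1 / Real.log (1 / ε)) *
        ∫ ω, (fibreGrowth T θ f d ε ω).toReal ∂P : ℝ) : EReal)) (𝓝[>] 0) := by
  set s : ℝ → ℝ := fun ε => 1 / Real.log (1 / ε) * ∫ ω, (fibreGrowth T θ f d ε ω).toReal ∂P
  set g : ℝ → ℝ := fun ε => (pressure P T θ f d ε).toReal / Real.log (1 / ε)
  have hsmall : ∀ᶠ ε : ℝ in 𝓝[>] 0, 0 < ε ∧ 2 * ε < 1 := by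
    filter_upwards [Ioo_mem_nhdsGT (show (0 : ℝ) < 1 / 2 by norm_num)] with ε hε
    exact ⟨hε.1, by linarith [hε.2]⟩
  have hpg : (fun ε : ℝ => pressure P T θ f d ε / ((Real.log (1 / ε) : ℝ) : EReal)) =ᶠ[𝓝[>] 0]
      fun ε => (g ε : EReal) := by
    filter_upwards [hsmall] with ε ⟨hε, hε'⟩
    rw [← coe_toReal_pressure hθ hf hε hε', EReal.coe_div]
  have hgs : ∀ᶠ ε in 𝓝[>] 0, (g ε : EReal) ≤ (s ε : EReal) := by
    filter_upwards [hsmall] with ε ⟨hε, hε'⟩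
    have hε1 : ε < 1 := by linarith
    have h := pressure_le_integral_fibreGrowth (T := T) hθ hf hε hε1
    rw [← coe_toReal_pressure hθ hf hε hε', EReal.coe_le_coe_iff] at h
    refine EReal.coe_le_coe_iff.2 ?_
    simp only [g, s]
    rw [one_div_mul_eq_div]
    refine div_le_div_of_nonneg_right h (Real.log_nonneg ?_)
    rw [le_div_iff₀ hε]
    linarith
  have h2lim : Tendsto (fun ε : ℝ => 2 * ε) (𝓝[>] 0) (𝓝[>] 0) := map_two_mul_nhdsGT_zero.le
  have hlog : Tendsto (fun ε : ℝ => Real.log (1 / (2 * ε))) (𝓝[>] 0) atTop :=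
    tendsto_log_one_div.comp h2lim
  have hc : Tendsto (fun ε : ℝ => 1 + Real.log 2 / Real.log (1 / (2 * ε))) (𝓝[>] 0) (𝓝 1) := by
    simpa using (hlog.const_div_atTop (Real.log 2)).const_add 1
  -- This is the integrated excess divided by log(1/(2ε)): the logarithm in front of the oscillation
  -- cancels.
  have he : Tendsto (fun ε : ℝ => ∫ ω, osc f (2 * ε) ω ∂P +
      Real.log 2 * (∫ ω, ‖f ω‖ ∂P) / Real.log (1 / (2 * ε))) (𝓝[>] 0) (𝓝 0) := by
    simpa using ((tendsto_integral_osc hf).comp h2lim).add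
      (hlog.const_div_atTop (Real.log 2 * ∫ ω, ‖f ω‖ ∂P))
  have hsg : ∀ᶠ ε in 𝓝[>] 0, s (2 * ε) ≤ (1 + Real.log 2 / Real.log (1 / (2 * ε))) * g ε +
      (∫ ω, osc f (2 * ε) ω ∂P +
        Real.log 2 * (∫ ω, ‖f ω‖ ∂P) / Real.log (1 / (2 * ε))) := by
    filter_upwards [hsmall] with ε ⟨hε, hε'⟩
    have h := integral_fibreGrowth_two_mul_le_pressure (T := T) hθ hf hε hε'
    rw [← coe_toReal_pressure hθ hf hε hε', EReal.coe_le_coe_iff] at h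
    have hex : ∫ ω, scaleExcess f ε ω ∂P = Real.log (1 / (2 * ε)) * ∫ ω, osc f (2 * ε) ω ∂P +
        Real.log 2 * ∫ ω, ‖f ω‖ ∂P := by
      simp only [scaleExcess]
      rw [integral_add ((integrable_osc hf _).const_mul _) (hf.integrable_norm.const_mul _),
        integral_const_mul, integral_const_mul]
    have hl2 : 0 < Real.log (1 / (2 * ε)) :=
      Real.log_pos (by rw [lt_div_iff₀ (by positivity)]; linarith)
    have hl1 : Real.log (1 / ε) = Real.log (1 / (2 * ε)) + Real.log 2 := by
      rw [← Real.log_mul (by positivity) (by norm_num)]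
      congr 1
      field_simp
    have hl : 0 < Real.log (1 / ε) := by
      rw [hl1]
      exact add_pos hl2 (Real.log_pos one_lt_two)
    have hcg : (1 + Real.log 2 / Real.log (1 / (2 * ε))) * g ε =
        (pressure P T θ f d ε).toReal / Real.log (1 / (2 * ε)) := by
      rw [one_add_div hl2.ne', ← hl1]
      simp only [g]
      field_simp
    rw [hcg]
    simp only [s]
    rw [one_div_mul_eq_div, div_le_iff₀ hl2]
    rw [hex] at h
    field_simp
    linarith
  unfold upperMdim lowerMdim
  rw [limsup_congr hpg, liminf_congr hpg]
  exact ⟨le_antisymm (limsup_le_limsup hgs) (limsup_le_limsup_of_two_mul_le hc he hsg),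
    le_antisymm (liminf_le_liminf hgs) (liminf_le_liminf_of_two_mul_le hc he hsg)⟩

end Growth

end RandomMdim

end

theorem proposition2p2 {Ω X : Type*} [MeasurableSpace Ω] (P : Measure Ω) [IsProbabilityMeasure P]
    (θ : Ω → Ω) (hθ : MeasurePreserving θ P P)
    [tX : TopologicalSpace X] [CompactSpace X] [TopologicalSpace.MetrizableSpace X] [Nonempty X]
    [MeasurableSpace X] [BorelSpace X]
    (T : RandomMdim.FibreMaps Ω X)
    (f : Ω → C(X, ℝ)) (hf : RandomMdim.MemL1C P f)
    -- `d` is a metric on `X` that is compatible with the given topology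
    (d : MetricSpace X) (hd : d.toUniformSpace.toTopologicalSpace = tX) :
    -- all quantities are well defined: the suprema are finite, the integrands are integrable
    (∀ ε : ℝ, 0 < ε → ε < 1 →
      (∀ n : ℕ, 1 ≤ n →
        (∀ ω, BddAbove (RandomMdim.sepSums T θ f d n ω ε)) ∧
        Measurable (fun ω => RandomMdim.sepP T θ f d n ω ε) ∧
        Integrable (fun ω => Real.log (RandomMdim.sepP T θ f d n ω ε)) P) ∧
      (∀ᵐ ω ∂P, RandomMdim.fibreGrowth T θ f d ε ω ≠ ⊤ ∧
        RandomMdim.fibreGrowth T θ f d ε ω ≠ ⊥) ∧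
      Integrable (fun ω => (RandomMdim.fibreGrowth T θ f d ε ω).toReal) P) ∧
    RandomMdim.upperMdim P T θ f d =
      limsup (fun ε : ℝ => (((1 / Real.log (1 / ε)) *
        ∫ ω, (RandomMdim.fibreGrowth T θ f d ε ω).toReal ∂P : ℝ) : EReal)) (𝓝[>] 0) ∧
    RandomMdim.lowerMdim P T θ f d =
      liminf (fun ε : ℝ => (((1 / Real.log (1 / ε)) *
        ∫ ω, (RandomMdim.fibreGrowth T θ f d ε ω).toReal ∂P : ℝ) : EReal)) (𝓝[>] 0) := by
  -- The given topology becomes the one induced by d, so the metric-space lemmas apply.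
  subst hd
  refine ⟨fun ε hε hε' => ⟨fun n _ => ⟨fun ω => ?_, ?_, ?_⟩, ?_, ?_⟩, RandomMdim.mdim_eq hθ hf⟩
  · obtain ⟨C, -, hC⟩ := RandomMdim.exists_covBy T θ f hε
      (show 1 < 1 / ε by rw [lt_div_iff₀ hε]; linarith)
    exact (hC n ω).bddAbove
  · exact RandomMdim.measurable_sepP hθ.measurable hf.measurable hε hε' n
  · exact RandomMdim.integrable_log_sepP hθ hf hε hε' n
  · exact RandomMdim.ae_fibreGrowth_ne hθ hf hε hε'
  · exact RandomMdim.integrable_toReal_fibreGrowth hθ hf hε hε'
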